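/- Let $\Gamma$ be a finite set of colours and let $\mathcal F\subseteq\mathcal P(\Gamma)$ be a Muller condition. Let $L_{\mathcal F}=\{w\in\Gamma^\omega : \mathrm{Inf}(w)\in\mathcal F\}$, where $\mathrm{Inf}(w)$ is the set of letters that occur infinitely often in $w$. **Automata.** A Rabin automaton is a deterministic, complete, transition-based automaton with finitely many states, input alphabet $\Gamma$ and a finite output alphabet $C$. It has finitely many Rabin pairs $(E_i,F_i)$ with $E_i,F_i\subseteq C$. A word is accepted if the word $u\in C^\omega$ produced by its run satisfies $\mathrm{Inf}(u)\cap E_i\neq\emptyset$ and $\mathrm{Inf}(u)\cap F_i=\emptyset$ for some $i$. The size is the number of states. **Games.** An $\mathcal F$-game consists of a directed graph $(V,E)$ with $E\subseteq V\times V$ in which every vertex has an outgoing edge, a partition $V=V_E\uplus V_A$ into vertices of Eve and of Adam, an initial vertex $v_0$, and a colouring $\gamma:E\to\Gamma\cup\{\varepsilon\}$ such that no cycle is labelled by $\varepsilon$ only. The graph may be infinite. A play is an infinite path from $v_0$; Eve wins it if and only if deleting all $\varepsilon$'s from its sequence of colours leaves an infinite word in $L_{\mathcal F}$. The game is $\varepsilon$-free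 if no edge is coloured $\varepsilon$. Eve wins the game if she has a strategy $\sigma:E^*\to E$ (choosing an outgoing edge after every partial play that ends in $V_E$) such that she wins every play that adheres to it. **Memories.** A memory structure for a game is a triple $(M,m_0,\mu)$ with $m_0\in M$ and $\mu:M\times E\to M$; its size is $|M|$. It sets a winning strategy if, for some function $V_E\times M\to E$ selecting outgoing edges, Eve wins by always playing the edge selected at the current vertex and current memory state. It is chromatic if there is $\mu':M\times\Gamma\to M$ with $\mu(m,e)=\mu'(m,\gamma(e))$ when $\gamma(e)\ne\varepsilon$ and $\mu(m,e)=m$ when $\gamma(e)=\varepsilon$. An arena-independent memory for $\mathcal F$ over a class of games is a triple $(M,m_0,\mu':M\times\Gamma\to M)$ with $M$ finite whose induced chromatic memory sets a winning strategy in every $\mathcal F$-game of the class that Eve wins. The chromatic memory requirement of $\mathcal F$ over a class of games is the least integer $n\ge 1$ such that every $\mathcal F$-game of the class that Eve wins can be won by her with a chromatic memory of size $n$. **Theorem.** For every finite set $\Gamma$ and every Muller condition $\mathcal F\subseteq\mathcal P(\Gamma)$, the following quantities all exist and coincide: 1. the size of a minimal Rabin automaton recognising $L_{\mathcal F}$;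 2. the size of a minimal arena-independent memory for $\mathcal F$ over all games; 3. the size of a minimal arena-independent memory for $\mathcal F$ over $\varepsilon$-free games; 4. the chromatic memory requirement of $\mathcal F$ over all games; 5. the chromatic memory requirement of $\mathcal F$ over $\varepsilon$-free games. Moreover, quantities 2–5 keep the same value when the games are restricted to those with finitely many vertices. -/

import Mathlib

universe u v

namespace ChromaticMemory

/-! ## Infinite words and acceptance conditions -/

/-- The letters that occur infinitely often in an infinite word. -/
def infOcc {A : Type v} (w : ℕ → A) : Set A :=
  {a | ∃ᶠ i in Filter.atTop, w i = a}

/-- The language `L_F` of the Muller condition `F`: words whose set of infinitely recurring letters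
belongs to `F`. -/
def mullerLanguage {A : Type v} (F : Set (Set A)) : Set (ℕ → A) :=
  {w | infOcc w ∈ F}

/-- The words accepted by the Rabin condition with pairs `(E i, F i)`, `i < r`. -/
def rabinLanguage {A : Type v} {r : ℕ} (E F : Fin r → Set A) : Set (ℕ → A) :=
  {w | ∃ i, (infOcc w ∩ E i).Nonempty ∧ infOcc w ∩ F i = ∅}

/-! ## Deterministic complete transition-based automata -/

/-- A deterministic complete automaton with input alphabet `A`; each transition produces a letter
of the output alphabet, and `acc` is the set of accepted outputs. -/
structure Automaton (A : Type v) where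
  State : Type
  finite_state : Finite State
  start : State
  Output : Type
  finite_output : Finite Output
  step : State → A → State × Output
  acc : Set (ℕ → Output)

namespace Automaton

/-- The state reached after reading the first `n` letters of `w`. -/
def stateAt {A : Type v} (𝒜 : Automaton A) (w : ℕ → A) : ℕ → 𝒜.State
  | 0 => 𝒜.start
  | n + 1 => (𝒜.step (𝒜.stateAt w n) (w n)).1

/-- The output word produced by `w`. -/
def output {A : Type v} (𝒜 : Automaton A) (w : ℕ → A) : ℕ → 𝒜.Output :=
  fun n => (𝒜.step (𝒜.stateAt w n) (w n)).2

/-- The language accepted by the automaton. -/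
def language {A : Type v} (𝒜 : Automaton A) : Set (ℕ → A) :=
  {w | 𝒜.output w ∈ 𝒜.acc}

/-- The acceptance condition is given by a finite family of Rabin pairs. -/
def IsRabin {A : Type v} (𝒜 : Automaton A) : Prop :=
  ∃ (r : ℕ) (E F : Fin r → Set 𝒜.Output), 𝒜.acc = rabinLanguage E F

end Automaton

/-- The sizes (numbers of states) of the Rabin automata recognising `L`. -/
def rabinSizes {A : Type v} (L : Set (ℕ → A)) : Set ℕ :=
  {n | ∃ 𝒜 : Automaton A, 𝒜.IsRabin ∧ 𝒜.language = L ∧ Nat.card 𝒜.State = n}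

/-! ## Games -/

/-- An arena coloured by `Γ ∪ {ε}`: a directed graph with vertices partitioned into those of Eve
(`eve`) and those of Adam (the complement), an initial vertex and a colouring of the edges, where
`none` is the neutral colour `ε`. A game is an arena with a winning condition `W ⊆ Γ^ω`. -/
structure Arena (Γ : Type v) where
  Vertex : Type u
  eve : Set Vertex
  edges : Set (Vertex × Vertex)
  start : Vertex
  colour : edges → Option Γ
  exists_edge : ∀ x, ∃ y, (x, y) ∈ edges
  no_eps_cycle : ∀ x, ¬ Relation.TransGen
    (fun a b => ∃ h : (a, b) ∈ edges, colour ⟨(a, b), h⟩ = none) x x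

namespace Arena

/-- The type of edges. -/
abbrev Edge {Γ : Type v} (G : Arena.{u, v} Γ) : Type u := G.edges

/-- The source of an edge. -/
def src {Γ : Type v} (G : Arena.{u, v} Γ) (e : G.Edge) : G.Vertex := e.1.1

/-- The target of an edge. -/
def tgt {Γ : Type v} (G : Arena.{u, v} Γ) (e : G.Edge) : G.Vertex := e.1.2

/-- No edge is coloured by `ε`. -/
def EpsFree {Γ : Type v} (G : Arena.{u, v} Γ) : Prop := ∀ e, G.colour e ≠ none

/-- Partial plays: finite paths starting in the initial vertex. -/
def IsPartialPlay {Γ : Type v} (G : Arena.{u, v} Γ) (l : List G.Edge) : Prop :=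
  (∀ e ∈ l.head?, G.src e = G.start) ∧ l.IsChain (fun e f => G.tgt e = G.src f)

/-- The vertex in which a partial play ends. -/
def lastVertex {Γ : Type v} (G : Arena.{u, v} Γ) (l : List G.Edge) : G.Vertex :=
  match l.getLast? with
  | none => G.start
  | some e => G.tgt e

/-- Plays: infinite paths starting in the initial vertex. -/
def IsPlay {Γ : Type v} (G : Arena.{u, v} Γ) (ρ : ℕ → G.Edge) : Prop :=
  G.src (ρ 0) = G.start ∧ ∀ n, G.tgt (ρ n) = G.src (ρ (n + 1))

/-- `w` is the output of `ρ`: the infinite word that remains after removing every `ε` from the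
sequence of colours of `ρ`. The function `φ` enumerates the positions not coloured by `ε`. -/
def IsOutput {Γ : Type v} (G : Arena.{u, v} Γ) (ρ : ℕ → G.Edge) (w : ℕ → Γ) : Prop :=
  ∃ φ : ℕ → ℕ, StrictMono φ ∧ Set.range φ = {i | G.colour (ρ i) ≠ none} ∧
    ∀ n, G.colour (ρ (φ n)) = some (w n)

/-- The sequence of edges `ρ` is winning for Eve for the winning condition `W`: its output belongs
to `W`. -/
def IsWinningPlay {Γ : Type v} (G : Arena.{u, v} Γ) (W : Set (ℕ → Γ)) (ρ : ℕ → G.Edge) : Prop :=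
  ∃ w, G.IsOutput ρ w ∧ w ∈ W

/-- A strategy for Eve, `σ : E* → E`: to each partial play ending in a vertex of Eve it associates
an edge leaving that vertex (its values elsewhere are irrelevant). -/
def IsStrategy {Γ : Type v} (G : Arena.{u, v} Γ) (σ : List G.Edge → G.Edge) : Prop :=
  ∀ l, G.IsPartialPlay l → G.lastVertex l ∈ G.eve → G.src (σ l) = G.lastVertex l

/-- The finite prefix of `ρ` of length `n`. -/
def prefixOf {Γ : Type v} (G : Arena.{u, v} Γ) (ρ : ℕ → G.Edge) (n : ℕ) : List G.Edge :=
  (List.range n).map ρ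

/-- The play `ρ` adheres to the strategy `σ`. -/
def Adheres {Γ : Type v} (G : Arena.{u, v} Γ) (σ : List G.Edge → G.Edge) (ρ : ℕ → G.Edge) : Prop :=
  ∀ n, G.lastVertex (G.prefixOf ρ n) ∈ G.eve → ρ n = σ (G.prefixOf ρ n)

/-- `σ` is a winning strategy for Eve in the game with winning condition `W`. -/
def IsWinningStrategy {Γ : Type v} (G : Arena.{u, v} Γ) (W : Set (ℕ → Γ))
    (σ : List G.Edge → G.Edge) : Prop :=
  G.IsStrategy σ ∧ ∀ ρ, G.IsPlay ρ → G.Adheres σ ρ → G.IsWinningPlay W ρ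

/-- Eve wins the game with winning condition `W`. -/
def EveWins {Γ : Type v} (G : Arena.{u, v} Γ) (W : Set (ℕ → Γ)) : Prop :=
  ∃ σ, G.IsWinningStrategy W σ

/-- Some edge leaving a given vertex. -/
noncomputable def someEdge {Γ : Type v} (G : Arena.{u, v} Γ) (x : G.Vertex) : G.Edge :=
  ⟨(x, (G.exists_edge x).choose), (G.exists_edge x).choose_spec⟩

end Arena

/-! ## Memory structures -/

/-- A memory structure for a game. -/
structure Memory {Γ : Type v} (G : Arena.{u, v} Γ) where
  State : Type
  start : State
  update : State → G.Edge → State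

namespace Memory

/-- The memory state after a sequence of edges. -/
def stateAfter {Γ : Type v} {G : Arena.{u, v} Γ} (M : Memory G) (l : List G.Edge) : M.State :=
  l.foldl M.update M.start

/-- The strategy defined by a memory structure and a next-move function: after the partial play `l`
ending in a vertex `x` of Eve, play `next x m`, where `m` is the current memory state. (The value at
lists that do not end in a vertex of Eve is irrelevant.) -/
noncomputable def strategy {Γ : Type v} {G : Arena.{u, v} Γ} (M : Memory G)
    (next : G.eve → M.State → G.Edge) (l : List G.Edge) : G.Edge :=
  open Classical in
  if h : G.lastVertex l ∈ G.eve then next ⟨G.lastVertex l, h⟩ (M.stateAfter l)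
  else G.someEdge (G.lastVertex l)

/-- The memory structure sets a winning strategy for Eve in the game with winning condition `W`. -/
def SetsWinningStrategy {Γ : Type v} {G : Arena.{u, v} Γ} (M : Memory G)
    (W : Set (ℕ → Γ)) : Prop :=
  ∃ next : G.eve → M.State → G.Edge, (∀ x m, G.src (next x m) = x) ∧
    G.IsWinningStrategy W (M.strategy next)

/-- The update only depends on the colour of the edge, and `ε` does not change the state. -/
def IsChromatic {Γ : Type v} {G : Arena.{u, v} Γ} (M : Memory G) : Prop :=
  ∃ f : M.State → Γ → M.State, ∀ m e,
    (∀ c, G.colour e = some c → M.update m e = f m c) ∧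
    (G.colour e = none → M.update m e = m)

end Memory

/-- A memory skeleton over the colours `Γ`: memory states, an initial state and an update function
reading colours. -/
structure ColourMemory (Γ : Type v) where
  State : Type
  start : State
  update : State → Γ → State

namespace ColourMemory

/-- The memory structure induced in a game; `ε` does not change the state. -/
def toMemory {Γ : Type v} (M : ColourMemory Γ) (G : Arena.{u, v} Γ) : Memory G where
  State := M.State
  start := M.start
  update m e :=
    match G.colour e with
    | none => m
    | some c => M.update m c

/-- `M` is an arena-independent memory for `W` over the class `C` of games: in every game of `C`
with winning condition `W` that is won by Eve, it sets a winning strategy for her. -/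
def IsArenaIndependent {Γ : Type v} (M : ColourMemory Γ) (C : Set (Arena.{u, v} Γ))
    (W : Set (ℕ → Γ)) : Prop :=
  ∀ G ∈ C, G.EveWins W → (M.toMemory G).SetsWinningStrategy W

end ColourMemory

/-- The sizes of the (finite) arena-independent memories for `W` over the class `C` of games. -/
def independentSizes {Γ : Type v} (C : Set (Arena.{u, v} Γ)) (W : Set (ℕ → Γ)) : Set ℕ :=
  {n | ∃ M : ColourMemory Γ, Finite M.State ∧ Nat.card M.State = n ∧ M.IsArenaIndependent C W}

/-- The positive integers `n` such that every game of the class `C` with winning condition `W` that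
is won by Eve can be won by her with a chromatic memory of size `n`. The least such `n` is the
chromatic memory requirement of `W` over `C`. -/
def chromaticSizes {Γ : Type v} (C : Set (Arena.{u, v} Γ)) (W : Set (ℕ → Γ)) : Set ℕ :=
  {n | 0 < n ∧ ∀ G ∈ C, G.EveWins W →
    ∃ M : Memory G, Finite M.State ∧ Nat.card M.State = n ∧ M.IsChromatic ∧
      M.SetsWinningStrategy W}

/-- All games. -/
def allGames (Γ : Type v) : Set (Arena.{u, v} Γ) := Set.univ

/-- The games without `ε`-transitions. -/
def epsFreeGames (Γ : Type v) : Set (Arena.{u, v} Γ) := {G | G.EpsFree}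

/-- The games with finitely many vertices. -/
def finiteGames (Γ : Type v) : Set (Arena.{u, v} Γ) := {G | Finite G.Vertex}

end ChromaticMemory

/-!
Each quantity is compared with the least number of states of a Rabin automaton, which exists because
the appearance record of `recencyMemory` carries a Rabin condition for the Muller language.

A Rabin automaton with `n` states is an arena-independent memory. In the product of a game with the
automaton Eve has a Rabin winning condition; its rejected sets are closed under unions, even if `ε`
is regarded as one more colour. For such conditions Eve wins positionally on arenas of any size
(`exists_positional`). The proof is by induction on the set `C` of colours, with a positional
strategy that wins on a region that cannot be enlarged. If `C` is accepting, let `X` be the largest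
rejecting set; there seeing colours outside `X` infinitely often is enough, and where Eve cannot force
this the game only uses colours of `X`. If `C` is rejecting and some vertex lies outside the region,
then some strategy of Eve avoids a colour altogether from some point on, since otherwise a play that
agrees with a winning strategy could see all colours infinitely often. The induction hypothesis
applies to what this strategy can reach, so the region was not maximal.

Conversely, let chromatic memories of size `n` suffice in the finite `ε`-free games. Then some memory
skeleton with `n` states has the property `ColourMemory.RejectsUnions`: the union of two rejecting
cycles through a common reachable state is rejecting. Indeed a skeleton that violates it loses a game
in which Eve has to alternate between two loops at one vertex, where the skeleton is always in the
same state; letting Adam choose first among such games, one for each of the finitely many skeletons,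
gives one game in which all of them fail (`mem_rabinSizes_of_mem_chromaticSizes`). A skeleton with
this property is turned into a Rabin automaton with the same states by
`ColourMemory.RejectsUnions.mem_rabinSizes`, since each accepting cycle has a transition that lies on
no rejecting cycle contained in it.
-/

namespace ChromaticMemory

/-! ### Letters occurring infinitely often -/

theorem infOcc_shift {A : Type*} (w : ℕ → A) (n : ℕ) :
    infOcc (fun i => w (i + n)) = infOcc w := by
  ext a
  have h := Filter.map_add_atTop_eq_nat n
  simp only [infOcc, Set.mem_ofPred_eq]
  conv_rhs => rw [← h, Filter.frequently_map]

theorem exists_mem_infOcc {A : Type*} [Finite A] {w : ℕ → A} {X : Set A}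
    (h : ∃ᶠ i in Filter.atTop, w i ∈ X) : ∃ a ∈ infOcc w, a ∈ X := by
  by_contra! hX
  refine h ?_
  have h1 : ∀ a, ∀ᶠ i in Filter.atTop, a ∈ X → w i ≠ a := by
    intro a
    by_cases ha : a ∈ X
    · have : a ∉ infOcc w := fun h => hX a h ha
      filter_upwards [Filter.not_frequently.1 this] with i hi _ using hi
    · exact Filter.Eventually.of_forall fun i h => absurd h ha
  filter_upwards [Filter.eventually_all.2 h1] with i hi hw using hi _ hw rfl

theorem infOcc_subset {A : Type*} {w : ℕ → A} {X : Set A}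
    (h : ∀ᶠ i in Filter.atTop, w i ∈ X) : infOcc w ⊆ X := by
  intro a ha
  obtain ⟨i, hi, hX⟩ := (Filter.Frequently.and_eventually ha h).exists
  exact hi ▸ hX

/-! ### Paths realising every event infinitely often -/

/-- From `t` one can perform `k` steps of `r` and then a step of `r` that satisfies `g`. -/
def ReachIn {T : Type*} (r g : T → T → Prop) : ℕ → T → Prop
  | 0, t => ∃ b, r t b ∧ g t b
  | k + 1, t => ∃ b, r t b ∧ ReachIn r g k b

theorem exists_reachIn {T : Type*} {r g : T → T → Prop} {t a b : T}
    (h : Relation.ReflTransGen r t a) (hr : r a b) (hg : g a b) : ∃ k, ReachIn r g k t := by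
  induction h using Relation.ReflTransGen.head_induction_on with
  | refl => exact ⟨0, b, hr, hg⟩
  | head h _ ih => obtain ⟨k, hk⟩ := ih; exact ⟨k + 1, _, h, hk⟩

/-- If each of countably many events can be reached from each vertex of a closed set `Q`, then some
infinite path realises all of them infinitely often. -/
theorem exists_path_frequently {T ι : Type*} [Nonempty ι] [Countable ι] {Q : Set T}
    {r : T → T → Prop} {g : ι → T → T → Prop} (hQ : ∀ t ∈ Q, ∀ b, r t b → b ∈ Q)
    (h : ∀ t ∈ Q, ∀ i, ∃ k, ReachIn r (g i) k t) {t : T} (ht : t ∈ Q) :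
    ∃ p : ℕ → T, p 0 = t ∧ (∀ n, r (p n) (p (n + 1))) ∧
      ∀ i, ∃ᶠ n in Filter.atTop, g i (p n) (p (n + 1)) := by
  obtain ⟨f₀, hf₀⟩ := exists_surjective_nat ι
  obtain ⟨f, hf⟩ : ∃ f : ℕ → ι, ∀ i N, ∃ n ≥ N, f n = i := by
    refine ⟨fun n => f₀ n.unpair.1, fun i N => ?_⟩
    obtain ⟨k, hk⟩ := hf₀ i
    exact ⟨Nat.pair k N, Nat.right_le_pair k N, by simp [hk]⟩
  -- A state consists of the current vertex, the number of the event to be realised next and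
  -- the number of steps that remain before it.
  let S := {s : T × ℕ × ℕ // s.1 ∈ Q ∧ ReachIn r (g (f s.2.1)) s.2.2 s.1}
  have hnext : ∀ s : S, ∃ s' : S, r s.1.1 s'.1.1 ∧
      ((s.1.2.2 = 0 ∧ s'.1.2.1 = s.1.2.1 + 1 ∧ g (f s.1.2.1) s.1.1 s'.1.1) ∨
        (s.1.2.2 = s'.1.2.2 + 1 ∧ s'.1.2.1 = s.1.2.1)) := by
    rintro ⟨⟨a, n, k⟩, ha, hk⟩
    cases k with
    | zero =>
      obtain ⟨b, hab, hb⟩ := hk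
      obtain ⟨k', hk'⟩ := h b (hQ a ha b hab) (f (n + 1))
      exact ⟨⟨⟨b, n + 1, k'⟩, hQ a ha b hab, hk'⟩, hab, Or.inl ⟨rfl, rfl, hb⟩⟩
    | succ k =>
      obtain ⟨b, hab, hb⟩ := hk
      exact ⟨⟨⟨b, n, k⟩, hQ a ha b hab, hb⟩, hab, Or.inr ⟨rfl, rfl⟩⟩
  choose next hr hprog using hnext
  obtain ⟨k₀, hk₀⟩ := h t ht (f 0)
  let s : ℕ → S := fun n => Nat.rec ⟨⟨t, 0, k₀⟩, ht, hk₀⟩ (fun _ s => next s) n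
  have hs : ∀ n, s (n + 1) = next (s n) := fun n => rfl
  have hreach : ∀ k m, (s m).1.2.2 = k →
      ∃ m', (s m').1.2.2 = 0 ∧ (s m').1.2.1 = (s m).1.2.1 := by
    intro k
    induction k with
    | zero => exact fun m hm => ⟨m, hm, rfl⟩
    | succ k ih =>
      intro m hm
      rcases hprog (s m) with h | ⟨h1, h2⟩
      · omega
      · rw [← hs] at h1 h2
        obtain ⟨m', h3, h4⟩ := ih (m + 1) (by omega)
        exact ⟨m', h3, h4.trans h2⟩
  have hall : ∀ n, ∃ m, (s m).1.2.1 = n ∧ (s m).1.2.2 = 0 := by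
    intro n
    induction n with
    | zero =>
      obtain ⟨m, h1, h2⟩ := hreach _ 0 rfl
      exact ⟨m, h2, h1⟩
    | succ n ih =>
      obtain ⟨m, h1, h2⟩ := ih
      rcases hprog (s m) with ⟨-, h, -⟩ | ⟨h, -⟩
      · obtain ⟨m', h3, h4⟩ := hreach _ (m + 1) rfl
        exact ⟨m', by rw [h4, hs, h, h1], h3⟩
      · omega
  have hle : ∀ m, (s m).1.2.1 ≤ m := by
    intro m
    induction m with
    | zero => exact le_rfl
    | succ m ih =>
      rw [hs]
      rcases hprog (s m) with ⟨-, h, -⟩ | ⟨-, h⟩ <;> omega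
  refine ⟨fun n => (s n).1.1, rfl, fun n => hr (s n), fun i => Filter.frequently_atTop.2 ?_⟩
  intro N
  obtain ⟨n, hn, hi⟩ := hf i N
  obtain ⟨m, hm, hm0⟩ := hall n
  refine ⟨m, hn.trans (hm ▸ hle m), ?_⟩
  rcases hprog (s m) with ⟨-, -, h⟩ | ⟨h, -⟩
  · rw [hm, hi] at h
    exact h
  · omega

/-! ### Positional strategies for conditions whose complement is closed under unions -/

/-- The colours of the edges traversed by an infinite path. -/
def colourWord {V K : Type*} (col : V → V → K) (p : ℕ → V) : ℕ → K :=
  fun n => col (p n) (p (n + 1))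

/-- A partial positional strategy: on the region `U`, Eve plays according to `τ`. An edge that agrees
with `τ` stays in `U` unless it belongs to `D`, and a play from `U` that agrees with `τ` and avoids
`D` is won by Eve for the Muller condition `F`. -/
structure PosWin {V K : Type*} (eve : Set V) (col : V → V → K) (F : Set (Set K))
    (E D : V → V → Prop) (R U : Set V) (τ : V → V) : Prop where
  subset : U ⊆ R
  edge : ∀ x ∈ U, x ∈ eve → E x (τ x)
  stay : ∀ x ∈ U, ∀ y, E x y → (x ∈ eve → y = τ x) → D x y ∨ y ∈ U
  win : ∀ p : ℕ → V, p 0 ∈ U → (∀ n, E (p n) (p (n + 1))) → (∀ n, p n ∈ eve → p (n + 1) = τ (p n)) →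
    (∀ n, ¬ D (p n) (p (n + 1))) → infOcc (colourWord col p) ∈ F

section PosWin

variable {V K : Type*} {eve : Set V} {col : V → V → K} {F : Set (Set K)} {E D : V → V → Prop}
  {R : Set V}

theorem PosWin.mem {U : Set V} {τ : V → V} (h : PosWin eve col F E D R U τ) {p : ℕ → V}
    (h0 : p 0 ∈ U) (hE : ∀ n, E (p n) (p (n + 1)))
    (hτ : ∀ n, p n ∈ U → p n ∈ eve → p (n + 1) = τ (p n))
    (hD : ∀ n, ¬ D (p n) (p (n + 1))) (n : ℕ) : p n ∈ U := by
  induction n with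
  | zero => exact h0
  | succ n ih => exact (h.stay _ ih _ (hE n) (hτ n ih)).resolve_left (hD n)

/-- There is a partial positional strategy that cannot be extended to a larger region. -/
theorem exists_maximal_posWin (eve : Set V) (col : V → V → K) (F : Set (Set K))
    (E D : V → V → Prop) (R : Set V) : ∃ U τ, PosWin eve col F E D R U τ ∧
      ∀ U' τ', PosWin eve col F E D R U' τ' → U ⊆ U' → Set.EqOn τ τ' U → U' ⊆ U := by
  classical
  let S := {s : Set V × (V → V) // PosWin eve col F E D R s.1 s.2}
  let le : S → S → Prop := fun s s' => s.1.1 ⊆ s'.1.1 ∧ Set.EqOn s.1.2 s'.1.2 s.1.1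
  obtain ⟨m, hm⟩ : ∃ m : S, ∀ a, le m a → le a m := by
    refine exists_maximal_of_chains_bounded ?_
      (fun {a b c} h1 h2 => ⟨h1.1.trans h2.1, h1.2.trans (h2.2.mono h1.1)⟩)
    intro c hc
    let τ : V → V := fun x => if h : ∃ s ∈ c, x ∈ s.1.1 then h.choose.1.2 x else x
    have hτ : ∀ s ∈ c, Set.EqOn s.1.2 τ s.1.1 := by
      intro s hs x hx
      have h : ∃ s ∈ c, x ∈ s.1.1 := ⟨s, hs, hx⟩
      have h1 := h.choose_spec
      have : τ x = h.choose.1.2 x := dif_pos h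
      rw [this]
      rcases eq_or_ne s h.choose with he | he
      · rw [← he]
      · rcases hc hs h1.1 he with h2 | h2
        · exact h2.2 hx
        · exact (h2.2 h1.2).symm
    refine ⟨⟨⟨⋃ s ∈ c, s.1.1, τ⟩, ?_⟩,
      fun s hs => ⟨Set.subset_biUnion_of_mem (u := fun s : S => s.1.1) hs, hτ s hs⟩⟩
    constructor
    · exact Set.iUnion₂_subset fun s _ => s.2.subset
    · intro x hx hxe
      obtain ⟨s, hs, hx⟩ := Set.mem_iUnion₂.1 hx
      change E x (τ x)
      rw [← hτ s hs hx]
      exact s.2.edge x hx hxe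
    · intro x hx y hxy hy
      obtain ⟨s, hs, hx⟩ := Set.mem_iUnion₂.1 hx
      simp only [← hτ s hs hx] at hy
      exact (s.2.stay x hx y hxy hy).imp id fun h => Set.mem_iUnion₂.2 ⟨s, hs, h⟩
    · intro p h0 hE hp hD
      obtain ⟨s, hs, h0⟩ := Set.mem_iUnion₂.1 h0
      have hmem := s.2.mem h0 hE (fun n hn he => (hp n he).trans (hτ s hs hn).symm) hD
      exact s.2.win p h0 hE (fun n he => (hp n he).trans (hτ s hs (hmem n)).symm) hD
  exact ⟨m.1.1, m.1.2, m.2, fun U' τ' h hU hτ => (hm ⟨⟨U', τ'⟩, h⟩ ⟨hU, hτ⟩).1⟩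

/-- A maximal region contains every set `W` on which Eve has a positional strategy that wins the
plays staying in `W` forever, and whose other plays enter the region or traverse an edge of `D`. -/
theorem subset_of_maximal_posWin {U : Set V} {τ : V → V} (h : PosWin eve col F E D R U τ)
    (hmax : ∀ U' τ', PosWin eve col F E D R U' τ' → U ⊆ U' → Set.EqOn τ τ' U → U' ⊆ U)
    {W : Set V} (hWR : W ⊆ R) (ρ : V → V) (hedge : ∀ x ∈ W, x ∈ eve → E x (ρ x))
    (hstay : ∀ x ∈ W, ∀ y, E x y → (x ∈ eve → y = ρ x) → D x y ∨ y ∈ U ∨ y ∈ W)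
    (hwin : ∀ p : ℕ → V, (∀ n, p n ∈ W) → (∀ n, p n ∉ U) → (∀ n, E (p n) (p (n + 1))) →
      (∀ n, p n ∈ eve → p (n + 1) = ρ (p n)) → (∀ n, ¬ D (p n) (p (n + 1))) →
      infOcc (colourWord col p) ∈ F) : W ⊆ U := by
  classical
  let τ' : V → V := fun x => if x ∈ U then τ x else ρ x
  have hτ' : ∀ x ∈ U, τ' x = τ x := fun x hx => if_pos hx
  have hρ' : ∀ x ∉ U, τ' x = ρ x := fun x hx => if_neg hx
  refine Set.subset_union_right.trans (hmax (U ∪ W) τ' ?_ Set.subset_union_left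
    fun x hx => (hτ' x hx).symm)
  have hmem : ∀ x ∈ U ∪ W, x ∉ U → x ∈ W := fun x hx hU => hx.resolve_left hU
  have hst : ∀ x ∈ U ∪ W, ∀ y, E x y → (x ∈ eve → y = τ' x) → D x y ∨ y ∈ U ∪ W := by
    intro x hx y hxy hy
    by_cases hU : x ∈ U
    · rw [hτ' x hU] at hy
      exact (h.stay x hU y hxy hy).imp id Or.inl
    · rw [hρ' x hU] at hy
      exact hstay x (hmem x hx hU) y hxy hy
  constructor
  · exact Set.union_subset h.subset hWR
  · intro x hx he
    by_cases hU : x ∈ U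
    · rw [hτ' x hU]; exact h.edge x hU he
    · rw [hρ' x hU]; exact hedge x (hmem x hx hU) he
  · exact hst
  · intro p h0 hE hp hD
    by_cases hex : ∃ n, p n ∈ U
    · obtain ⟨n, hn⟩ := hex
      have hU := h.mem (p := fun i => p (i + n)) (by simpa using hn)
        (fun i => by have := hE (i + n); rwa [add_right_comm] at this)
        (fun i hi he => by
          have := hp (i + n) he
          rwa [hτ' _ hi, add_right_comm] at this)
        (fun i => by have := hD (i + n); rwa [add_right_comm] at this)
      have := h.win (fun i => p (i + n)) (by simpa using hn)
        (fun i => by have := hE (i + n); rwa [add_right_comm] at this)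
        (fun i he => by
          have := hp (i + n) he
          rwa [hτ' _ (hU i), add_right_comm] at this)
        (fun i => by have := hD (i + n); rwa [add_right_comm] at this)
      rw [← infOcc_shift _ n]
      convert this using 3 with i
      simp [colourWord, add_right_comm]
    · push Not at hex
      have hW : ∀ n, p n ∈ U ∪ W := by
        intro n
        induction n with
        | zero => exact h0
        | succ n ih => exact (hst _ ih _ (hE n) (hp n)).resolve_left (hD n)
      exact hwin p (fun n => hmem _ (hW n) (hex n)) hex hE
        (fun n he => (hp n he).trans (hρ' _ (hex n))) hD

/-- In a maximal region, an Eve vertex with an edge in `D` or into the region is absorbed. -/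
theorem mem_of_maximal_posWin {U : Set V} {τ : V → V} (h : PosWin eve col F E D R U τ)
    (hmax : ∀ U' τ', PosWin eve col F E D R U' τ' → U ⊆ U' → Set.EqOn τ τ' U → U' ⊆ U)
    {x y : V} (hx : x ∈ R) (he : x ∈ eve) (hxy : E x y) (hy : D x y ∨ y ∈ U) : x ∈ U := by
  refine subset_of_maximal_posWin h hmax (W := {x}) (by simpa using hx) (fun _ => y)
    (by rintro _ rfl _; exact hxy) ?_ ?_ rfl
  · rintro _ rfl z _ hz
    rw [hz he]
    exact hy.imp id Or.inl
  · intro p hW hU hE hp hD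
    have h0 : p 0 = x := hW 0
    have h1 : p 1 = y := hp 0 (h0 ▸ he)
    have := hD 0
    rw [zero_add, h0, h1] at this
    exact absurd (hy.resolve_left this) (h1 ▸ hU 1)

end PosWin

/-- **Positional strategies suffice for Eve.** Let `F` be a Muller condition whose complement is closed under
unions. An arbitrary winning strategy of Eve is represented by a graph `step` on `Q` lying over the
game graph: over a vertex of Eve it has at least one edge, over a vertex of Adam it lifts all
edges, and all its infinite paths are won by Eve. Then Eve wins positionally from all the vertices
that lie below `Q`. -/
theorem exists_positional {V T K : Type*} [Finite K] {eve : Set V} {col : V → V → K}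
    {F : Set (Set K)} (hF : ∀ X ∉ F, ∀ Y ∉ F, X ∪ Y ∉ F) (hF0 : ∅ ∉ F) (π : T → V) (C : Set K)
    (E : V → V → Prop) (R : Set V) (Q : Set T) (step : T → T → Prop)
    (hRQ : ∀ x ∈ R, ∃ t ∈ Q, π t = x) (hQR : ∀ t ∈ Q, π t ∈ R)
    (hE : ∀ x ∈ R, ∀ y, E x y → y ∈ R ∧ col x y ∈ C)
    (hstep : ∀ t ∈ Q, ∀ t', step t t' → t' ∈ Q ∧ E (π t) (π t'))
    (heve : ∀ t ∈ Q, π t ∈ eve → ∃ t', step t t')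
    (hadam : ∀ t ∈ Q, π t ∉ eve → ∀ y, E (π t) y → ∃ t', step t t' ∧ π t' = y)
    (hwin : ∀ p : ℕ → T, p 0 ∈ Q → (∀ n, step (p n) (p (n + 1))) →
      infOcc (colourWord col (π ∘ p)) ∈ F) :
    ∃ τ : V → V, (∀ x ∈ R, x ∈ eve → E x (τ x)) ∧
      ∀ p : ℕ → V, p 0 ∈ R → (∀ n, E (p n) (p (n + 1))) →
        (∀ n, p n ∈ eve → p (n + 1) = τ (p n)) → infOcc (colourWord col p) ∈ F := by
  induction hC : C.ncard using Nat.strong_induction_on generalizing C E R Q step with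
  | _ N ih =>
  subst hC
  have ih' := fun C' (h : C' ⊂ C) => ih C'.ncard (Set.ncard_lt_ncard h) C'
  clear ih
  have hmemR : ∀ p : ℕ → V, p 0 ∈ R → (∀ n, E (p n) (p (n + 1))) → ∀ n, p n ∈ R := by
    intro p h0 hp n
    induction n with
    | zero => exact h0
    | succ n ih => exact (hE _ ih _ (hp n)).1
  by_cases hCF : C ∈ F
  · -- `C` is accepting: a play is won as soon as it sees colours outside `X` infinitely often.
    obtain ⟨X, hX⟩ := (Set.toFinite {X : Set K | X ⊆ C ∧ X ∉ F}).exists_maximal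
      ⟨∅, Set.empty_subset _, hF0⟩
    have hXC : X ⊂ C := hX.prop.1.ssubset_of_ne fun h => hX.prop.2 (h ▸ hCF)
    have hXmax : ∀ Y ⊆ C, Y ∉ F → Y ⊆ X := fun Y hY hYF =>
      Set.subset_union_right.trans (hX.le_of_ge
        ⟨Set.union_subset hXC.subset hY, hF X hX.prop.2 Y hYF⟩ Set.subset_union_left)
    obtain ⟨U, τ, hU, hmax⟩ :=
      exists_maximal_posWin eve col F E (fun x y => col x y ∉ X) R
    have hRU : R ⊆ U := by
      obtain ⟨ρ, hρ, hρwin⟩ := ih' X hXC (fun x y => E x y ∧ y ∉ U ∧ col x y ∈ X) (R \ U)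
        {t | t ∈ Q ∧ π t ∉ U}
        (fun t t' => step t t' ∧ π t' ∉ U ∧ col (π t) (π t') ∈ X)
        (fun x hx => by
          obtain ⟨t, ht, rfl⟩ := hRQ x hx.1
          exact ⟨t, ⟨ht, hx.2⟩, rfl⟩)
        (fun t ht => ⟨hQR t ht.1, ht.2⟩)
        (fun x hx y hxy => ⟨⟨(hE x hx.1 y hxy.1).1, hxy.2.1⟩, hxy.2.2⟩)
        (fun t ht t' htt' => ⟨⟨(hstep t ht.1 t' htt'.1).1, htt'.2.1⟩,
          (hstep t ht.1 t' htt'.1).2, htt'.2⟩)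
        (fun t ht he => by
          obtain ⟨t', htt'⟩ := heve t ht.1 he
          have := not_or.1 fun h => ht.2 (mem_of_maximal_posWin hU hmax (hQR t ht.1) he
            (hstep t ht.1 t' htt').2 h)
          exact ⟨t', htt', this.2, not_not.1 this.1⟩)
        (fun t ht he y hy => by
          obtain ⟨t', htt', rfl⟩ := hadam t ht.1 he y hy.1
          exact ⟨t', ⟨htt', hy.2⟩, rfl⟩)
        (fun p h0 hp => hwin p h0.1 fun n => (hp n).1) rfl
      intro x hx
      by_contra hxU
      refine hxU (subset_of_maximal_posWin hU hmax (W := R \ U) Set.sdiff_subset ρ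
        (fun x hx he => (hρ x hx he).1) ?_ ?_ ⟨hx, hxU⟩)
      · intro x hx y hxy _
        by_cases hy : y ∈ U
        · exact Or.inr (Or.inl hy)
        · exact Or.inr (Or.inr ⟨(hE x hx.1 y hxy).1, hy⟩)
      · intro p hW hpU hpE hp hD
        exact hρwin p (hW 0) (fun n => ⟨hpE n, hpU _, not_not.1 (hD n)⟩) hp
    refine ⟨τ, fun x hx => hU.edge x (hRU hx), fun p h0 hpE hp => ?_⟩
    by_cases hfr : ∃ᶠ n in Filter.atTop, colourWord col p n ∈ Xᶜ
    · obtain ⟨c, hc, hcX⟩ := exists_mem_infOcc hfr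
      by_contra hneg
      refine hcX (hXmax _ (infOcc_subset (Filter.Eventually.of_forall fun n => ?_)) hneg hc)
      exact (hE _ (hmemR p h0 hpE n) _ (hpE n)).2
    · rw [Filter.not_frequently, Filter.eventually_atTop] at hfr
      obtain ⟨n, hn⟩ := hfr
      have := hU.win (fun i => p (i + n)) (hRU (hmemR p h0 hpE _))
        (fun i => by have := hpE (i + n); rwa [add_right_comm] at this)
        (fun i he => by have := hp (i + n) he; rwa [add_right_comm] at this)
        (fun i => by have := hn (i + n) (by omega); simpa [colourWord, add_right_comm] using this)
      rw [← infOcc_shift _ n]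
      convert this using 3 with i
      simp [colourWord, add_right_comm]
  · rcases C.eq_empty_or_nonempty with hC0 | hC0
    · subst hC0
      refine ⟨id, fun x hx he => ?_, fun p h0 hpE _ => ((hE _ h0 _ (hpE 0)).2).elim⟩
      obtain ⟨t, ht, rfl⟩ := hRQ x hx
      obtain ⟨t', htt'⟩ := heve t ht he
      exact ((hE _ hx _ (hstep t ht t' htt').2).2).elim
    obtain ⟨U, τ, hU, hmax⟩ := exists_maximal_posWin eve col F E (fun _ _ => False) R
    suffices hRU : R ⊆ U from ⟨τ, fun x hx => hU.edge x (hRU hx), fun p h0 hpE hp =>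
      hU.win p (hRU h0) hpE hp fun _ => id⟩
    intro x hx
    by_contra hxU
    obtain ⟨t₀, ht₀, rfl⟩ := hRQ x hx
    let r : T → T → Prop := fun t t' => step t t' ∧ π t' ∉ U
    let Q₁ : Set T := {t | t ∈ Q ∧ π t ∉ U}
    have hQ₁ : ∀ t ∈ Q₁, ∀ t', r t t' → t' ∈ Q₁ := fun t ht t' h =>
      ⟨(hstep t ht.1 t' h.1).1, h.2⟩
    by_cases hall : ∀ t ∈ Q₁, ∀ c : C, ∃ k, ReachIn r (fun a b => col (π a) (π b) = c) k t
    · -- All colours can be seen infinitely often outside `U`, which contradicts `C ∉ F`.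
      have : Nonempty C := hC0.to_subtype
      obtain ⟨p, hp0, hpr, hpc⟩ := exists_path_frequently hQ₁ hall ⟨ht₀, hxU⟩
      have hpQ : ∀ n, p n ∈ Q₁ := by
        intro n
        induction n with
        | zero => exact hp0 ▸ ⟨ht₀, hxU⟩
        | succ n ih => exact hQ₁ _ ih _ (hpr n)
      have hw := hwin p (hpQ 0).1 fun n => (hpr n).1
      have : infOcc (colourWord col (π ∘ p)) = C := by
        apply Set.Subset.antisymm
        · refine infOcc_subset (Filter.Eventually.of_forall fun n => ?_)
          exact (hE _ (hQR _ (hpQ n).1) _ (hstep _ (hpQ n).1 _ (hpr n).1).2).2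
        · exact fun c hc => hpc ⟨c, hc⟩
      exact hCF (this ▸ hw)
    · -- The colour `c` cannot be seen from `t₁` outside `U`.
      push Not at hall
      obtain ⟨t₁, ht₁, ⟨c, hcC⟩, hc⟩ := hall
      let Q₂ : Set T := {t | Relation.ReflTransGen r t₁ t}
      have hQ₂ : ∀ t ∈ Q₂, t ∈ Q₁ := by
        intro t ht
        induction ht with
        | refl => exact ht₁
        | tail _ h ih => exact hQ₁ _ ih _ h
      have hcol : ∀ t ∈ Q₂, ∀ t', r t t' → t' ∈ Q₂ ∧ E (π t) (π t') ∧ π t' ∈ π '' Q₂ ∧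
          col (π t) (π t') ∈ C \ {c} := by
        intro t ht t' htt'
        have h1 : t' ∈ Q₂ := Relation.ReflTransGen.tail ht htt'
        have h2 := (hstep t (hQ₂ t ht).1 t' htt'.1).2
        refine ⟨h1, h2, Set.mem_image_of_mem π h1, (hE _ (hQR t (hQ₂ t ht).1) _ h2).2, fun h => ?_⟩
        obtain ⟨k, hk⟩ := exists_reachIn (g := fun a b => col (π a) (π b) = c) ht htt' h
        exact hc k hk
      have hU₂ : ∀ x ∈ π '' Q₂, x ∈ R ∧ x ∉ U := by
        rintro _ ⟨t, ht, rfl⟩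
        exact ⟨hQR t (hQ₂ t ht).1, (hQ₂ t ht).2⟩
      have hadam₂ : ∀ x ∈ π '' Q₂, x ∉ eve → ∀ y, E x y → y ∉ U →
          y ∈ π '' Q₂ ∧ col x y ∈ C \ {c} := by
        rintro _ ⟨t, ht, rfl⟩ he y hy hyU
        obtain ⟨t', htt', rfl⟩ := hadam t (hQ₂ t ht).1 he y hy
        exact (hcol t ht t' ⟨htt', hyU⟩).2.2
      obtain ⟨ρ, hρ, hρwin⟩ := ih' (C \ {c})
        ⟨Set.sdiff_subset, fun h => (h hcC).2 rfl⟩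
        (fun x y => E x y ∧ y ∈ π '' Q₂ ∧ col x y ∈ C \ {c}) (π '' Q₂) Q₂ r
        (fun x hx => hx) (fun t ht => Set.mem_image_of_mem π ht)
        (fun x hx y hxy => hxy.2) hcol
        (fun t ht he => by
          obtain ⟨t', htt'⟩ := heve t (hQ₂ t ht).1 he
          refine ⟨t', htt', fun h => (hQ₂ t ht).2 ?_⟩
          exact mem_of_maximal_posWin hU hmax (hQR t (hQ₂ t ht).1) he
            (hstep t (hQ₂ t ht).1 t' htt').2 (Or.inr h))
        (fun t ht he y hy => by
          obtain ⟨t', htt', rfl⟩ := hadam t (hQ₂ t ht).1 he y hy.1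
          exact ⟨t', ⟨htt', (hU₂ _ hy.2.1).2⟩, rfl⟩)
        (fun p h0 hp => hwin p (hQ₂ _ h0).1 fun n => (hp n).1) rfl
      have ht₁Q : π t₁ ∈ π '' Q₂ := Set.mem_image_of_mem π Relation.ReflTransGen.refl
      refine (hU₂ _ ht₁Q).2 (subset_of_maximal_posWin hU hmax (W := π '' Q₂)
        (fun x hx => (hU₂ x hx).1) ρ (fun x hx he => (hρ x hx he).1) ?_ ?_ ht₁Q)
      · intro x hx y hxy hy
        by_cases he : x ∈ eve
        · rw [hy he]
          exact Or.inr (Or.inr (hρ x hx he).2.1)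
        · by_cases hyU : y ∈ U
          · exact Or.inr (Or.inl hyU)
          · exact Or.inr (Or.inr (hadam₂ x hx he y hxy hyU).1)
      · intro p hW hpU hpE hp _
        refine hρwin p (hW 0) (fun n => ?_) hp
        by_cases he : p n ∈ eve
        · rw [hp n he]
          exact hρ _ (hW n) he
        · exact ⟨hpE n, hadam₂ _ (hW n) he _ (hpE n) (hpU _)⟩

/-! ### Neutral colours -/

theorem infOcc_subsequence {A : Type*} {x : ℕ → Option A} {φ : ℕ → ℕ} {z : ℕ → A}
    (hφ : StrictMono φ) (hr : Set.range φ = {i | x i ≠ none}) (hz : ∀ n, x (φ n) = some (z n)) :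
    infOcc z = some ⁻¹' infOcc x := by
  ext a
  simp only [infOcc, Set.mem_preimage, Set.mem_ofPred_eq, Filter.frequently_atTop]
  constructor
  · intro h N
    obtain ⟨n, hn, rfl⟩ := h N
    exact ⟨φ n, hn.trans (hφ.id_le n), hz n⟩
  · intro h N
    obtain ⟨i, hi, hia⟩ := h (φ N)
    obtain ⟨n, rfl⟩ : i ∈ Set.range φ := by rw [hr]; simp [hia]
    exact ⟨n, hφ.le_iff_le.1 hi, Option.some_injective _ ((hz n).symm.trans hia)⟩

namespace Arena

variable {Γ : Type v} {G : Arena.{u, v} Γ}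

theorem IsOutput.colour_eq {ρ : ℕ → G.Edge} {w : ℕ → Γ} (hG : G.EpsFree) (h : G.IsOutput ρ w)
    (n : ℕ) : G.colour (ρ n) = some (w n) := by
  obtain ⟨φ, hφ, hr, hw⟩ := h
  have : φ = id := by
    refine (StrictMono.range_inj hφ strictMono_id).1 ?_
    rw [hr, Set.range_id]
    exact Set.eq_univ_of_forall fun i => hG (ρ i)
  subst this
  exact hw n

theorem isOutput_of_epsFree {ρ : ℕ → G.Edge} {w : ℕ → Γ} (h : ∀ n, G.colour (ρ n) = some (w n)) :
    G.IsOutput ρ w :=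
  ⟨id, strictMono_id, by simp [h], h⟩

theorem exists_isOutput {ρ : ℕ → G.Edge}
    (h : ∃ᶠ i in Filter.atTop, G.colour (ρ i) ≠ none) : ∃ w, G.IsOutput ρ w := by
  have hinf : {i | G.colour (ρ i) ≠ none}.Infinite := Nat.frequently_atTop_iff_infinite.1 h
  have hne : ∀ n, ∃ c, G.colour (ρ (Nat.nth (fun i => G.colour (ρ i) ≠ none) n)) = some c :=
    fun n => Option.ne_none_iff_exists'.1 (Nat.nth_mem_of_infinite hinf n)
  choose w hw using hne
  exact ⟨w, _, Nat.nth_strictMono hinf, Nat.range_nth_of_infinite hinf, hw⟩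

theorem lastVertex_concat (l : List G.Edge) (e : G.Edge) : G.lastVertex (l ++ [e]) = G.tgt e := by
  simp [lastVertex]

theorem prefixOf_succ (ρ : ℕ → G.Edge) (n : ℕ) :
    G.prefixOf ρ (n + 1) = G.prefixOf ρ n ++ [ρ n] := by
  simp [prefixOf, List.range_succ]

theorem lastVertex_prefixOf {ρ : ℕ → G.Edge} (h : G.IsPlay ρ) (n : ℕ) :
    G.lastVertex (G.prefixOf ρ n) = G.src (ρ n) := by
  cases n with
  | zero => exact h.1.symm
  | succ n => rw [prefixOf_succ, lastVertex_concat, h.2]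

theorem isPartialPlay_concat {l : List G.Edge} {e : G.Edge} (hl : G.IsPartialPlay l)
    (he : G.src e = G.lastVertex l) : G.IsPartialPlay (l ++ [e]) := by
  constructor
  · cases l with
    | nil => simpa [lastVertex] using he
    | cons a l => simpa using hl.1
  · refine List.isChain_append.2 ⟨hl.2, List.isChain_singleton e, ?_⟩
    intro x hx y hy
    simp only [List.head?_cons, Option.mem_some_iff] at hy
    rw [Option.mem_def] at hx
    rw [← hy, he, lastVertex, hx]

end Arena

theorem Memory.stateAfter_prefixOf_succ {Γ : Type v} {G : Arena.{u, v} Γ} (M : Memory G)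
    (ρ : ℕ → G.Edge) (n : ℕ) : M.stateAfter (G.prefixOf ρ (n + 1)) =
      M.update (M.stateAfter (G.prefixOf ρ n)) (ρ n) := by
  rw [Arena.prefixOf_succ, Memory.stateAfter, List.foldl_append]
  rfl

/-! ### From Rabin automata to arena-independent memories -/

namespace Automaton

variable {Γ : Type v} {G : Arena.{u, v} Γ} (𝒜 : Automaton Γ)

/-- The structure of an automaton, as a memory skeleton. -/
def toColourMemory : ColourMemory Γ where
  State := 𝒜.State
  start := 𝒜.start
  update m c := (𝒜.step m c).1

/-- The output produced when the automaton in state `m` reads the colour of `e`; it is neutral when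
the colour is. -/
def edgeOutput (m : 𝒜.State) (e : G.Edge) : Option 𝒜.Output :=
  (G.colour e).map fun c => (𝒜.step m c).2

/-- The output of the automaton along the sequence of edges `ρ`, including neutral letters. -/
def edgeOutputs (ρ : ℕ → G.Edge) (n : ℕ) : Option 𝒜.Output :=
  𝒜.edgeOutput ((𝒜.toColourMemory.toMemory G).stateAfter (G.prefixOf ρ n)) (ρ n)

theorem infOcc_output {ρ : ℕ → G.Edge} {w : ℕ → Γ} (h : G.IsOutput ρ w) :
    infOcc (𝒜.output w) = some ⁻¹' infOcc (𝒜.edgeOutputs ρ) := by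
  obtain ⟨φ, hφ, hr, hw⟩ := h
  set m : ℕ → 𝒜.State := fun n => (𝒜.toColourMemory.toMemory G).stateAfter (G.prefixOf ρ n)
  have hnone : ∀ n, G.colour (ρ n) = none → m (n + 1) = m n := by
    intro n hn
    refine (Memory.stateAfter_prefixOf_succ _ ρ n).trans ?_
    simp [ColourMemory.toMemory, hn, m]
  have hsome : ∀ n c, G.colour (ρ n) = some c → m (n + 1) = (𝒜.step (m n) c).1 := by
    intro n c hn
    refine (Memory.stateAfter_prefixOf_succ _ ρ n).trans ?_
    simp [ColourMemory.toMemory, hn, m, toColourMemory]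
  have hrange : ∀ i, (∀ n, φ n ≠ i) → G.colour (ρ i) = none := by
    intro i hi
    by_contra hne
    have : i ∈ Set.range φ := by rw [hr]; exact hne
    obtain ⟨n, hn⟩ := this
    exact hi n hn
  have hconst : ∀ a b, a ≤ b → (∀ i, a ≤ i → i < b → G.colour (ρ i) = none) → m b = m a := by
    intro a b hab
    induction b, hab using Nat.le_induction with
    | base => exact fun _ => rfl
    | succ b hab ih =>
      intro h
      rw [hnone b (h b hab (Nat.lt_succ_self b)), ih fun i h1 h2 => h i h1 (by omega)]
  have hstate : ∀ n, m (φ n) = 𝒜.stateAt w n := by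
    intro n
    induction n with
    | zero =>
      refine hconst 0 _ (Nat.zero_le _) fun i _ hi => hrange i fun n hn => ?_
      have := hφ.monotone (Nat.zero_le n)
      omega
    | succ n ih =>
      have hlt : φ n < φ (n + 1) := hφ (Nat.lt_succ_self n)
      rw [hconst (φ n + 1) (φ (n + 1)) hlt fun i h1 h2 => hrange i fun k hk => ?_,
        hsome _ _ (hw n), ih]
      · rfl
      · have h3 : n < k := hφ.lt_iff_lt.1 (by omega)
        have h4 : k < n + 1 := hφ.lt_iff_lt.1 (by omega)
        omega
  refine infOcc_subsequence hφ ?_ fun n => ?_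
  · rw [hr]
    ext i
    simp [edgeOutputs, edgeOutput]
  · have h1 := hstate n
    simp only [m] at h1
    simp [edgeOutputs, edgeOutput, hw n, h1, output]

/-- The sets of possibly neutral outputs that satisfy one of the Rabin pairs. A play with finitely many
non-neutral colours only satisfies none of them. -/
def rabinSets {C : Type} {r : ℕ} (E F : Fin r → Set C) : Set (Set (Option C)) :=
  {X | ∃ i, (some ⁻¹' X ∩ E i).Nonempty ∧ some ⁻¹' X ∩ F i = ∅}

theorem union_notMem_rabinSets {C : Type} {r : ℕ} {E F : Fin r → Set C} {X Y : Set (Option C)}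
    (hX : X ∉ rabinSets E F) (hY : Y ∉ rabinSets E F) : X ∪ Y ∉ rabinSets E F := by
  rintro ⟨i, ⟨c, hc, hcE⟩, hF⟩
  rw [Set.preimage_union, Set.union_inter_distrib_right, Set.union_empty_iff] at hF
  rcases hc with hc | hc
  · exact hX ⟨i, ⟨c, hc, hcE⟩, hF.1⟩
  · exact hY ⟨i, ⟨c, hc, hcE⟩, hF.2⟩

theorem empty_notMem_rabinSets {C : Type} {r : ℕ} {E F : Fin r → Set C} :
    ∅ ∉ rabinSets E F := by
  rintro ⟨i, ⟨c, hc, -⟩, -⟩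
  exact hc

theorem isWinningPlay_iff {r : ℕ} {E F : Fin r → Set 𝒜.Output} (hacc : 𝒜.acc = rabinLanguage E F)
    (ρ : ℕ → G.Edge) :
    G.IsWinningPlay 𝒜.language ρ ↔ infOcc (𝒜.edgeOutputs ρ) ∈ rabinSets E F := by
  have key : ∀ w, G.IsOutput ρ w →
      (w ∈ 𝒜.language ↔ infOcc (𝒜.edgeOutputs ρ) ∈ rabinSets E F) := by
    intro w hw
    simp only [language, hacc, Set.mem_ofPred_eq, rabinLanguage, rabinSets, 𝒜.infOcc_output hw]
  constructor
  · rintro ⟨w, hw, hwL⟩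
    exact (key w hw).1 hwL
  · intro h
    obtain ⟨w, hw⟩ : ∃ w, G.IsOutput ρ w := by
      obtain ⟨i, ⟨c, hc, -⟩, -⟩ := h
      refine Arena.exists_isOutput (Filter.Frequently.mono hc fun n hn hnone => ?_)
      simp [edgeOutputs, edgeOutput, hnone] at hn
    exact ⟨w, hw, (key w hw).2 h⟩

/-- The structure of a Rabin automaton is an arena-independent memory for its language: a positional
strategy in the product of a game with the automaton is a strategy that uses the states of the
automaton as memory. -/
theorem isArenaIndependent_toColourMemory (h𝒜 : 𝒜.IsRabin) (C : Set (Arena.{u, v} Γ)) :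
    𝒜.toColourMemory.IsArenaIndependent C 𝒜.language := by
  classical
  intro G _ hG
  obtain ⟨r, E, F, hacc⟩ := h𝒜
  obtain ⟨σ, hσ, hσwin⟩ := hG
  have := 𝒜.finite_output
  set M : Memory G := 𝒜.toColourMemory.toMemory G with hM
  let eve : Set (G.Vertex × M.State) := {x | x.1 ∈ G.eve}
  let col : G.Vertex × M.State → G.Vertex × M.State → Option 𝒜.Output := fun x y =>
    if h : (x.1, y.1) ∈ G.edges then 𝒜.edgeOutput x.2 ⟨(x.1, y.1), h⟩ else none
  have hcol : ∀ (e : G.Edge) m m', col (G.src e, m) (G.tgt e, m') = 𝒜.edgeOutput m e :=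
    fun e m m' => dif_pos e.2
  -- The strategy `σ` as a graph on the partial plays that agree with it.
  let step : List G.Edge → List G.Edge → Prop := fun l l' =>
    ∃ e, l' = l ++ [e] ∧ G.src e = G.lastVertex l ∧ (G.lastVertex l ∈ G.eve → e = σ l)
  let Q : Set (List G.Edge) := {l | Relation.ReflTransGen step [] l}
  let π : List G.Edge → G.Vertex × M.State := fun l => (G.lastVertex l, M.stateAfter l)
  have hπ : ∀ l e, π (l ++ [e]) = (G.tgt e, M.update (M.stateAfter l) e) := by
    intro l e
    simp only [π, Arena.lastVertex_concat, Memory.stateAfter, List.foldl_append, List.foldl_cons,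
      List.foldl_nil]
  let edge : G.Vertex × M.State → G.Vertex × M.State → Prop := fun x y =>
    (∃ e, G.src e = x.1 ∧ y = (G.tgt e, M.update x.2 e)) ∧ y ∈ π '' Q
  have hQpp : ∀ l ∈ Q, G.IsPartialPlay l := by
    intro l hl
    induction hl with
    | refl => exact ⟨by simp, List.isChain_nil⟩
    | tail _ h ih =>
      obtain ⟨e, rfl, he, -⟩ := h
      exact Arena.isPartialPlay_concat ih he
  have hQstep : ∀ l ∈ Q, ∀ l', step l l' → l' ∈ Q := fun l hl l' h => Relation.ReflTransGen.tail hl h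
  have hwin : ∀ l ∈ Q, ∀ p : ℕ → List G.Edge, p 0 = l → (∀ n, step (p n) (p (n + 1))) →
      infOcc (colourWord col (π ∘ p)) ∈ rabinSets E F := by
    intro l hl
    induction hl with
    | refl =>
      intro p h0 hp
      choose ρ hρ hsrc hρσ using hp
      have hpre : ∀ n, p n = G.prefixOf ρ n := by
        intro n
        induction n with
        | zero => exact h0
        | succ n ih => rw [hρ, Arena.prefixOf_succ, ih]
      have hplay : G.IsPlay ρ := by
        constructor
        · rw [hsrc 0, h0]; rfl
        · intro n
          rw [hsrc (n + 1), hρ, Arena.lastVertex_concat]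
      have hw := hσwin ρ hplay fun n hn => by
        rw [← hpre] at hn ⊢
        exact hρσ n hn
      rw [𝒜.isWinningPlay_iff hacc] at hw
      convert hw using 2
      funext n
      simp only [colourWord, Function.comp, hρ, hπ]
      simp only [π, ← hsrc, hcol]
      rw [hpre]
      rfl
    | tail _ h ih =>
      rename_i l₁ l₂ _
      intro p h0 hp
      have := ih (fun n => Nat.casesOn n l₁ p) rfl fun n => by
        cases n with
        | zero => simpa [h0] using h
        | succ n => exact hp n
      rw [← infOcc_shift _ 1] at this
      exact this
  obtain ⟨τ, hτ, hτwin⟩ := exists_positional (eve := eve) (col := col) (F := rabinSets E F)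
    (fun X hX Y hY => union_notMem_rabinSets hX hY) empty_notMem_rabinSets π Set.univ edge (π '' Q)
    Q step (fun x hx => hx) (fun t ht => Set.mem_image_of_mem π ht)
    (fun x _ y hxy => ⟨hxy.2, Set.mem_univ _⟩)
    (fun l hl l' h => by
      have h1 := hQstep l hl l' h
      refine ⟨h1, ?_, Set.mem_image_of_mem π h1⟩
      obtain ⟨e, rfl, he, -⟩ := h
      exact ⟨e, he, hπ l e⟩)
    (fun l hl he => ⟨l ++ [σ l], σ l, rfl, hσ l (hQpp l hl) he, fun _ => rfl⟩)
    (fun l hl he y hy => by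
      obtain ⟨⟨e, he', rfl⟩, -⟩ := hy
      exact ⟨l ++ [e], ⟨e, rfl, he', fun h => absurd h he⟩, hπ l e⟩)
    (fun p h0 hp => hwin _ h0 p rfl hp)
  have hnext : ∀ (x : G.eve) (m : M.State), ∃ e, G.src e = x ∧
      ((x.1, m) ∈ π '' Q → τ (x.1, m) = (G.tgt e, M.update m e)) := by
    intro x m
    by_cases hx : (x.1, m) ∈ π '' Q
    · obtain ⟨⟨e, he, h⟩, -⟩ := hτ _ hx x.2
      exact ⟨e, he, fun _ => h⟩
    · exact ⟨G.someEdge x, rfl, fun h => absurd h hx⟩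
  choose next hsrc hnextτ using hnext
  refine ⟨next, hsrc, ?_, ?_⟩
  · intro l _ hl
    rw [Memory.strategy, dif_pos hl]
    exact hsrc _ _
  · intro ρ hρ had
    rw [𝒜.isWinningPlay_iff hacc]
    let p : ℕ → G.Vertex × M.State := fun n => (G.src (ρ n), M.stateAfter (G.prefixOf ρ n))
    have hpsucc : ∀ n, p (n + 1) = (G.tgt (ρ n), M.update (p n).2 (ρ n)) := by
      intro n
      simp only [p, Memory.stateAfter_prefixOf_succ, hρ.2]
    have hstepτ : ∀ n, p n ∈ π '' Q → p n ∈ eve → p (n + 1) = τ (p n) := by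
      intro n hn he
      have he' : G.lastVertex (G.prefixOf ρ n) ∈ G.eve := by
        rw [Arena.lastVertex_prefixOf hρ]; exact he
      have h1 := had n he'
      rw [Memory.strategy, dif_pos he'] at h1
      have h2 := hnextτ ⟨_, he'⟩ (M.stateAfter (G.prefixOf ρ n))
      rw [← h1] at h2
      simp only [Arena.lastVertex_prefixOf hρ] at h2
      rw [hpsucc]
      exact (h2 hn).symm
    have hQ : ∀ n, p n ∈ π '' Q := by
      intro n
      induction n with
      | zero =>
        refine ⟨[], Relation.ReflTransGen.refl, ?_⟩
        simp only [π, p, ← Arena.lastVertex_prefixOf hρ]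
        rfl
      | succ n ih =>
        by_cases he : p n ∈ eve
        · rw [hstepτ n ih he]
          exact (hτ _ ih he).2
        · obtain ⟨l, hl, hlp⟩ := ih
          have h1 : G.lastVertex l = G.src (ρ n) := congrArg Prod.fst hlp
          have h2 : M.stateAfter l = (p n).2 := congrArg Prod.snd hlp
          refine ⟨l ++ [ρ n], hQstep l hl _ ⟨ρ n, rfl, h1.symm, fun h => ?_⟩, ?_⟩
          · rw [h1] at h
            exact absurd h he
          · rw [hπ, hpsucc, h2]
    have := hτwin p (hQ 0) (fun n => ⟨⟨ρ n, rfl, hpsucc n⟩, hQ (n + 1)⟩)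
      fun n he => hstepτ n (hQ n) he
    convert this using 2
    funext n
    rw [colourWord, hpsucc]
    exact (hcol (ρ n) _ _).symm

end Automaton

/-! ### From memory skeletons to Rabin automata -/

theorem infOcc_comp {A B : Type*} [Finite A] (f : A → B) (w : ℕ → A) :
    infOcc (fun n => f (w n)) = f '' infOcc w := by
  ext b
  constructor
  · intro h
    exact exists_mem_infOcc (X := f ⁻¹' {b}) h
  · rintro ⟨a, ha, rfl⟩
    exact Filter.Frequently.mono ha fun n hn => congrArg f hn

namespace ColourMemory

variable {Γ : Type v} (M : ColourMemory Γ)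

/-- The state reached from `q` after reading the word `x`. -/
def run (q : M.State) (x : List Γ) : M.State := x.foldl M.update q

/-- The transitions traversed when the word `x` is read from the state `q`. -/
def transitions (q : M.State) : List Γ → Set (M.State × Γ)
  | [] => ∅
  | a :: x => insert (q, a) (transitions (M.update q a) x)

/-- The word `x` labels a nonempty cycle through the reachable state `q`. -/
def IsCycle (q : M.State) (x : List Γ) : Prop :=
  (∃ y, M.run M.start y = q) ∧ x ≠ [] ∧ M.run q x = q

/-- The word `x` labels a cycle at `q` whose set of letters is rejected by the Muller condition `F`. -/
def IsRejectingCycle (F : Set (Set Γ)) (q : M.State) (x : List Γ) : Prop :=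
  M.IsCycle q x ∧ {a | a ∈ x} ∉ F

/-- The union of two rejecting cycles that share a state is rejecting. -/
def RejectsUnions (F : Set (Set Γ)) : Prop :=
  ∀ q x y, M.IsRejectingCycle F q x → M.IsRejectingCycle F q y → {a | a ∈ x ++ y} ∉ F

variable {M}

theorem run_append (q : M.State) (x y : List Γ) : M.run q (x ++ y) = M.run (M.run q x) y :=
  List.foldl_append

theorem transitions_append (q : M.State) (x y : List Γ) :
    M.transitions q (x ++ y) = M.transitions q x ∪ M.transitions (M.run q x) y := by
  induction x generalizing q with
  | nil => simp [transitions, run]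
  | cons a x ih => simp [transitions, ih, run, Set.insert_union]

theorem mem_transitions {q s : M.State} {a : Γ} {x : List Γ} :
    (s, a) ∈ M.transitions q x ↔ ∃ y z, x = y ++ a :: z ∧ M.run q y = s := by
  induction x generalizing q with
  | nil => simp [transitions]
  | cons b x ih =>
    simp only [transitions, Set.mem_insert_iff, Prod.mk.injEq, ih]
    constructor
    · rintro (⟨rfl, rfl⟩ | ⟨y, z, rfl, rfl⟩)
      · exact ⟨[], x, rfl, rfl⟩
      · exact ⟨b :: y, z, rfl, rfl⟩
    · rintro ⟨y, z, h, rfl⟩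
      cases y with
      | nil =>
        simp only [List.nil_append, List.cons.injEq] at h
        exact Or.inl ⟨rfl, h.1.symm⟩
      | cons c y =>
        simp only [List.cons_append, List.cons.injEq] at h
        obtain ⟨rfl, rfl⟩ := h
        exact Or.inr ⟨y, z, rfl, rfl⟩

theorem letters_eq (q : M.State) (x : List Γ) :
    {a | a ∈ x} = Prod.snd '' M.transitions q x := by
  induction x generalizing q with
  | nil => simp [transitions]
  | cons a x ih =>
    rw [transitions, Set.image_insert_eq, ← ih]
    ext b
    simp

theorem IsRejectingCycle.rotate {F : Set (Set Γ)} {q : M.State} {x y : List Γ}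
    (h : M.IsRejectingCycle F q (x ++ y)) : M.IsRejectingCycle F (M.run q x) (y ++ x) ∧
      M.transitions (M.run q x) (y ++ x) = M.transitions q (x ++ y) := by
  obtain ⟨⟨⟨z, hz⟩, hne, hq⟩, hF⟩ := h
  have hq' : M.run (M.run q x) y = q := by rw [← run_append, hq]
  refine ⟨⟨⟨⟨z ++ x, by rw [run_append, hz]⟩, ?_, ?_⟩, ?_⟩, ?_⟩
  · simpa [and_comm] using hne
  · rw [run_append, hq']
  · convert hF using 3
    simp [or_comm]
  · rw [transitions_append, transitions_append, hq', Set.union_comm]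

theorem RejectsUnions.append {F : Set (Set Γ)} (hM : M.RejectsUnions F) {q : M.State}
    {x y : List Γ} (hx : M.IsRejectingCycle F q x) (hy : M.IsRejectingCycle F q y) :
    M.IsRejectingCycle F q (x ++ y) :=
  ⟨⟨hx.1.1, by simp [hx.1.2.1], by rw [run_append, hx.1.2.2, hy.1.2.2]⟩, hM q x y hx hy⟩

/-- An accepting cycle has a transition that lies on no rejecting cycle contained in it: otherwise
the accepting cycle would be a union of rejecting cycles, each sharing a state with the next. -/
theorem RejectsUnions.exists_transition {F : Set (Set Γ)} (hM : M.RejectsUnions F) {q : M.State}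
    {x : List Γ} (hx : M.IsCycle q x) (hF : {a | a ∈ x} ∈ F) :
    ∃ e ∈ M.transitions q x, ∀ s z, M.IsRejectingCycle F s z →
      M.transitions s z ⊆ M.transitions q x → e ∉ M.transitions s z := by
  by_contra! hcon
  have key : ∀ y z, x = y ++ z → y = [] ∨ ∃ w, M.IsRejectingCycle F (M.run q y) w ∧
      M.transitions (M.run q y) w ⊆ M.transitions q x ∧
      M.transitions q y ⊆ M.transitions (M.run q y) w := by
    intro y
    induction y using List.reverseRecOn with
    | nil => exact fun _ _ => Or.inl rfl
    | append_singleton y a ih =>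
      intro z hxz
      right
      have hxz' : x = y ++ a :: z := by simpa using hxz
      obtain ⟨s, z', hs, hsub, hmem⟩ := hcon _ (mem_transitions.2 ⟨y, z, hxz', rfl⟩)
      obtain ⟨z₁, z₂, rfl, hz₁⟩ := mem_transitions.1 hmem
      obtain ⟨hr, hrt⟩ := hs.rotate
      rw [hz₁] at hr hrt
      rw [← hrt] at hsub
      have ht : M.transitions q (y ++ [a]) = insert (M.run q y, a) (M.transitions q y) := by
        rw [transitions_append, Set.union_comm]
        simp [transitions]
      have hrun : M.run q (y ++ [a]) = M.run (M.run q y) [a] := run_append q y [a]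
      rcases ih _ hxz' with rfl | ⟨w, hw, hwsub, hwsup⟩
      · obtain ⟨h1, h2⟩ := IsRejectingCycle.rotate (x := [a]) (y := z₂ ++ z₁) (by simpa using hr)
        refine ⟨_, hrun ▸ h1, ?_, ?_⟩
        · rw [hrun, h2]
          simpa using hsub
        · rw [hrun, h2, ht]
          simp [transitions]
      · have h0 := hM.append hr hw
        obtain ⟨h1, h2⟩ := IsRejectingCycle.rotate (x := [a]) (y := z₂ ++ z₁ ++ w)
          (by simpa using h0)
        have h3 : M.transitions (M.run q y) ([a] ++ (z₂ ++ z₁ ++ w)) =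
            M.transitions (M.run q y) (a :: z₂ ++ z₁) ∪ M.transitions (M.run q y) w := by
          rw [show [a] ++ (z₂ ++ z₁ ++ w) = (a :: z₂ ++ z₁) ++ w by simp, transitions_append,
            hr.1.2.2]
        refine ⟨_, hrun ▸ h1, ?_, ?_⟩
        · rw [hrun, h2, h3]
          exact Set.union_subset hsub hwsub
        · rw [hrun, h2, h3, ht]
          refine Set.insert_subset (Or.inl ?_) (hwsup.trans Set.subset_union_right)
          simp [transitions]
  rcases key x [] (by simp) with h | ⟨w, hw, h1, h2⟩
  · exact hx.2.1 h
  · rw [hx.2.2] at hw h1 h2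
    apply hw.2
    rwa [letters_eq q w, h1.antisymm h2, ← letters_eq q x]

variable (M) in
/-- The state reached after reading the first `n` letters of `w`. -/
def stateAt (w : ℕ → Γ) : ℕ → M.State
  | 0 => M.start
  | n + 1 => M.update (stateAt w n) (w n)

theorem run_segment (w : ℕ → Γ) (i k : ℕ) :
    M.run (M.stateAt w i) ((List.range k).map fun n => w (i + n)) = M.stateAt w (i + k) := by
  induction k with
  | zero => rfl
  | succ k ih => simp only [List.range_succ, List.map_append, run_append, ih]; rfl

theorem transitions_segment (w : ℕ → Γ) (i k : ℕ) :
    M.transitions (M.stateAt w i) ((List.range k).map fun n => w (i + n)) =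
      {e | ∃ n < k, (M.stateAt w (i + n), w (i + n)) = e} := by
  induction k with
  | zero => simp [transitions]
  | succ k ih =>
    simp only [List.range_succ, List.map_append, transitions_append, ih, run_segment]
    ext e
    simp only [List.map_cons, List.map_nil, transitions, insert_empty_eq, Set.mem_union,
      Set.mem_ofPred_eq, Set.mem_singleton_iff]
    constructor
    · rintro (⟨n, hn, rfl⟩ | rfl)
      · exact ⟨n, by omega, rfl⟩
      · exact ⟨k, by omega, rfl⟩
    · rintro ⟨n, hn, rfl⟩
      rcases Nat.lt_succ_iff_lt_or_eq.1 hn with h | rfl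
      · exact Or.inl ⟨n, h, rfl⟩
      · exact Or.inr rfl

/-- The transitions traversed infinitely often by an infinite run are those of a cycle. -/
theorem exists_cycle [Finite Γ] [Finite M.State] (w : ℕ → Γ) : ∃ q x, M.IsCycle q x ∧
    M.transitions q x = infOcc fun n => (M.stateAt w n, w n) := by
  set t : ℕ → M.State × Γ := fun n => (M.stateAt w n, w n) with ht
  obtain ⟨N, hN⟩ : ∃ N, ∀ n ≥ N, t n ∈ infOcc t := by
    by_contra! hcon
    obtain ⟨e, he, he'⟩ := exists_mem_infOcc (w := t) (X := (infOcc t)ᶜ)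
      (Filter.frequently_atTop.2 hcon)
    exact he' he
  have hocc : ∀ e : infOcc t, ∃ k ≥ N, t k = e := fun e =>
    Filter.frequently_atTop.1 e.2 N
  choose k hk hke using hocc
  obtain ⟨B, hB⟩ := (Set.finite_range k).bddAbove
  obtain ⟨j, hj, hjN⟩ := Filter.frequently_atTop.1 (hN N le_rfl) (max (B + 1) (N + 1))
  have hlt : N < j := by omega
  refine ⟨M.stateAt w N, (List.range (j - N)).map fun n => w (N + n), ⟨⟨(List.range N).map w, ?_⟩,
    ?_, ?_⟩, ?_⟩
  · simpa [stateAt] using run_segment (M := M) w 0 N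
  · simp; omega
  · rw [run_segment, Nat.add_sub_cancel' hlt.le]
    exact congrArg Prod.fst hjN
  · rw [transitions_segment]
    ext e
    constructor
    · rintro ⟨n, -, rfl⟩
      exact hN (N + n) (by omega)
    · intro he
      have h1 := hk ⟨e, he⟩
      have h2 : k ⟨e, he⟩ ≤ B := hB ⟨_, rfl⟩
      refine ⟨k ⟨e, he⟩ - N, by omega, ?_⟩
      rw [Nat.add_sub_cancel' h1]
      exact hke ⟨e, he⟩

/-- If unions of rejecting cycles are rejecting, then a Rabin condition on the transitions of `M`
recognises the Muller language. Each set `T` of transitions gives a pair: no transition outside `T`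
recurs, and some recurring transition is on no rejecting cycle contained in `T`. -/
theorem RejectsUnions.mem_rabinSizes [Finite Γ] [Finite M.State] {F : Set (Set Γ)}
    (hM : M.RejectsUnions F) : Nat.card M.State ∈ rabinSizes (mullerLanguage F) := by
  obtain ⟨k, ⟨enc⟩⟩ := Finite.exists_equiv_fin Γ
  obtain ⟨r, ⟨num⟩⟩ := Finite.exists_equiv_fin (Set (M.State × Γ))
  let f : M.State × Γ → M.State × Fin k := Prod.map id enc
  have hf : Function.Injective f := Function.injective_id.prodMap enc.injective
  let good : Set (M.State × Γ) → Set (M.State × Γ) := fun T => {e | ∀ s z,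
    M.IsRejectingCycle F s z → M.transitions s z ⊆ T → e ∉ M.transitions s z}
  let E : Fin r → Set (M.State × Fin k) := fun i => f '' good (num.symm i)
  let E' : Fin r → Set (M.State × Fin k) := fun i => f '' (num.symm i)ᶜ
  let 𝒜 : Automaton Γ :=
    { State := M.State
      finite_state := ‹_›
      start := M.start
      Output := M.State × Fin k
      finite_output := inferInstance
      step := fun q a => (M.update q a, (q, enc a))
      acc := rabinLanguage E E' }
  refine ⟨𝒜, ⟨r, E, E', rfl⟩, ?_, rfl⟩
  ext w
  have hstate : ∀ n, 𝒜.stateAt w n = M.stateAt w n := by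
    intro n
    induction n with
    | zero => rfl
    | succ n ih => rw [Automaton.stateAt, ih]; rfl
  have hout : 𝒜.output w = fun n => f (M.stateAt w n, w n) := by
    funext n
    rw [Automaton.output, hstate]
    rfl
  set t : ℕ → M.State × Γ := fun n => (M.stateAt w n, w n) with ht
  obtain ⟨q, x, hx, hxt⟩ := exists_cycle (M := M) w
  have hw : infOcc w = {a | a ∈ x} := by
    rw [letters_eq q x, hxt, ← infOcc_comp]
  have hrabin : w ∈ 𝒜.language ↔ ∃ T, (M.transitions q x ∩ good T).Nonempty ∧
      M.transitions q x ⊆ T := by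
    change 𝒜.output w ∈ rabinLanguage E E' ↔ _
    rw [hout, rabinLanguage, Set.mem_ofPred_eq, infOcc_comp, num.symm.exists_congr_left]
    refine exists_congr fun T => ?_
    simp only [E, E', Equiv.symm_symm, Equiv.symm_apply_apply]
    rw [← Set.image_inter hf, ← Set.image_inter hf, Set.image_nonempty, Set.image_eq_empty,
      ← Set.sdiff_eq, Set.sdiff_eq_empty, hxt]
  rw [hrabin, mullerLanguage, Set.mem_ofPred_eq, hw]
  constructor
  · rintro ⟨T, ⟨e, he, heT⟩, hT⟩
    by_contra hF
    exact heT q x ⟨hx, hF⟩ hT he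
  · intro hF
    obtain ⟨e, he, h⟩ := hM.exists_transition hx hF
    exact ⟨_, ⟨e, he, h⟩, subset_rfl⟩

end ColourMemory

/-! ### Existence of a Rabin automaton -/

/-- The appearance record that remembers, for every two letters, whether the last occurrence of the
first one is later than that of the second one. Entries on the diagonal carry no information. -/
def recencyMemory (Γ : Type v) (k : ℕ) (enc : Γ → Fin k) : ColourMemory Γ where
  State := Fin k → Fin k → Prop
  start := fun _ _ => False
  update m c := fun a b => a = enc c ∨ (b ≠ enc c ∧ m a b)

theorem run_recencyMemory {Γ : Type v} {k : ℕ} {enc : Γ → Fin k} (henc : Function.Injective enc)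
    (q : (recencyMemory Γ k enc).State) (x : List Γ) {a b : Γ} (ha : a ∈ x) (hb : b ∉ x) :
    (recencyMemory Γ k enc).run q x (enc a) (enc b) ∧
      ¬ (recencyMemory Γ k enc).run q x (enc b) (enc a) := by
  induction x using List.reverseRecOn with
  | nil => simp at ha
  | append_singleton x c ih =>
    rw [ColourMemory.run_append]
    simp only [List.mem_append, List.mem_singleton, not_or] at ha hb
    have hbc : enc b ≠ enc c := fun h => hb.2 (henc h)
    change (enc a = enc c ∨ (enc b ≠ enc c ∧ _)) ∧ ¬ (enc b = enc c ∨ (enc a ≠ enc c ∧ _))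
    by_cases hac : a = c
    · subst hac
      simp [hbc]
    · have := ih (ha.resolve_right hac) hb.1
      exact ⟨Or.inr ⟨hbc, this.1⟩, by rintro (h | h); exacts [hbc h, this.2 h.2]⟩

/-- The sets of letters of the cycles through a given state of the appearance record form a chain. -/
theorem rejectsUnions_recencyMemory {Γ : Type v} {k : ℕ} {enc : Γ → Fin k}
    (henc : Function.Injective enc) (F : Set (Set Γ)) :
    (recencyMemory Γ k enc).RejectsUnions F := by
  intro q x y hx hy
  have hchain : {a | a ∈ x} ⊆ {a | a ∈ y} ∨ {a | a ∈ y} ⊆ {a | a ∈ x} := by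
    by_contra! hcon
    obtain ⟨⟨a, hax, hay⟩, ⟨b, hby, hbx⟩⟩ := And.imp Set.not_subset.1 Set.not_subset.1 hcon
    have h1 := (run_recencyMemory henc q x hax hbx).1
    have h2 := (run_recencyMemory henc q y hby hay).2
    rw [hx.1.2.2] at h1
    rw [hy.1.2.2] at h2
    exact h2 h1
  have hunion : {a | a ∈ x ++ y} = {a | a ∈ x} ∪ {a | a ∈ y} := by
    ext a
    simp
  rw [hunion]
  rcases hchain with h | h
  · rw [Set.union_eq_self_of_subset_left h]
    exact hy.2
  · rw [Set.union_eq_self_of_subset_right h]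
    exact hx.2

theorem rabinSizes_nonempty {Γ : Type v} [Finite Γ] (F : Set (Set Γ)) :
    (rabinSizes (mullerLanguage F)).Nonempty := by
  obtain ⟨k, ⟨enc⟩⟩ := Finite.exists_equiv_fin Γ
  have : Finite (recencyMemory Γ k enc).State :=
    inferInstanceAs (Finite (Fin k → Fin k → Prop))
  exact ⟨_, (rejectsUnions_recencyMemory enc.injective F).mem_rabinSizes⟩

/-! ### Games in which a memory cannot tell two loops apart -/

/-- Labels of a part of a game: a nonempty word leading to a vertex of Eve, and two nonempty words
labelling loops at this vertex, between which Eve chooses. Words are given by their first letter and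
the rest; the rests of the two loops differ, so that Eve's choice can be read off the next vertex. -/
structure Gadget (Γ : Type v) where
  stem : Γ × List Γ
  loop : Bool → Γ × List Γ
  ne : (loop true).2 ≠ (loop false).2

/-- The word labelling one of the two loops. -/
def Gadget.word {Γ : Type v} (g : Gadget Γ) (c : Bool) : List Γ := (g.loop c).1 :: (g.loop c).2

theorem Gadget.eq_of_loop_eq {Γ : Type v} (g : Gadget Γ) {c d : Bool}
    (h : (g.loop c).2 = (g.loop d).2) : c = d := by
  have := g.ne
  cases c <;> cases d <;> simp_all

/-- The moves of the game assembled from gadgets. In the root `none` Adam chooses a gadget; in a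
position `some (i, l)` of gadget `i` the word `l` remains to be read; for `l = []` Eve chooses a
loop. -/
inductive GadgetStep {Γ ι : Type v} (b : ι → Gadget Γ) :
    Option (ι × List Γ) → Option (ι × List Γ) → Prop
  | root (i : ι) : GadgetStep b none (some (i, (b i).stem.2))
  | choose (i : ι) (c : Bool) : GadgetStep b (some (i, [])) (some (i, ((b i).loop c).2))
  | read (i : ι) (a : Γ) (l : List Γ) : GadgetStep b (some (i, a :: l)) (some (i, l))

open Classical in
/-- The letter read by a move of the game assembled from gadgets; it is irrelevant for pairs of
positions that are not joined by a move. -/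
noncomputable def gadgetLetter {Γ ι : Type v} (b : ι → Gadget Γ) :
    Option (ι × List Γ) → Option (ι × List Γ) → Option Γ
  | none, some (i, _) => some (b i).stem.1
  | some (i, []), some (_, l) =>
      some (if l = ((b i).loop true).2 then ((b i).loop true).1 else ((b i).loop false).1)
  | some (_, a :: _), some _ => some a
  | _, none => none

section Gadget

variable {Γ ι : Type v} {b : ι → Gadget Γ}

theorem gadgetLetter_choose (i : ι) (c : Bool) :
    gadgetLetter b (some (i, [])) (some (i, ((b i).loop c).2)) = some ((b i).loop c).1 := by
  cases c
  · simp [gadgetLetter, (b i).ne.symm]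
  · simp [gadgetLetter]

theorem GadgetStep.letter_ne_none {s t : Option (ι × List Γ)} (h : GadgetStep b s t) :
    gadgetLetter b s t ≠ none := by
  cases h <;> simp [gadgetLetter]

/-- At most `B - 1` letters remain to be read in a position. -/
def GadgetBound (B : ℕ) (s : Option (ι × List Γ)) : Prop :=
  ∀ i l, s = some (i, l) → l.length < B

theorem GadgetStep.bound {B : ℕ}
    (hB : ∀ i, (b i).stem.2.length < B ∧ ∀ c, ((b i).loop c).2.length < B)
    {s t : Option (ι × List Γ)} (h : GadgetStep b s t) (hs : GadgetBound B s) :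
    GadgetBound B t := by
  intro j l hl
  cases h with
  | root i =>
    simp only [Option.some.injEq, Prod.mk.injEq] at hl
    rw [← hl.2]; exact (hB i).1
  | choose i c =>
    simp only [Option.some.injEq, Prod.mk.injEq] at hl
    rw [← hl.2]; exact (hB i).2 c
  | read i a l' =>
    simp only [Option.some.injEq, Prod.mk.injEq] at hl
    have := hs i _ rfl
    rw [← hl.2]
    exact (Nat.lt_succ_self _).trans this

theorem exists_gadgetStep [Nonempty ι] (s : Option (ι × List Γ)) : ∃ t, GadgetStep b s t := by
  rcases s with _ | ⟨i, _ | ⟨a, l⟩⟩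
  · exact ⟨_, .root (Classical.arbitrary ι)⟩
  · exact ⟨_, .choose i true⟩
  · exact ⟨_, .read i a l⟩

/-- A path from the root in the game assembled from gadgets, and the word it reads. -/
structure GadgetPath (b : ι → Gadget Γ) (s : ℕ → Option (ι × List Γ)) (w : ℕ → Γ) : Prop where
  start : s 0 = none
  step : ∀ n, GadgetStep b (s n) (s (n + 1))
  letter : ∀ n, gadgetLetter b (s n) (s (n + 1)) = some (w n)

namespace GadgetPath

variable {s : ℕ → Option (ι × List Γ)} {w : ℕ → Γ}

theorem read (h : GadgetPath b s w) {n : ℕ} {i : ι} {a : Γ} {l : List Γ}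
    (hn : s n = some (i, a :: l)) : s (n + 1) = some (i, l) ∧ w n = a := by
  have h1 := h.step n
  have h2 := h.letter n
  rw [hn] at h1 h2
  cases hs : s (n + 1) with
  | none => rw [hs] at h1; cases h1
  | some t =>
    rw [hs] at h1 h2
    cases h1
    exact ⟨rfl, (Option.some_injective _ h2).symm⟩

theorem choose (h : GadgetPath b s w) {n : ℕ} {i : ι} (hn : s n = some (i, [])) :
    ∃ c, s (n + 1) = some (i, ((b i).loop c).2) := by
  have h1 := h.step n
  rw [hn] at h1
  cases hs : s (n + 1) with
  | none => rw [hs] at h1; cases h1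
  | some t =>
    rw [hs] at h1
    cases h1 with
    | choose _ c => exact ⟨c, rfl⟩

theorem letter_choose (h : GadgetPath b s w) {n : ℕ} {i : ι} {c : Bool} (hn : s n = some (i, []))
    (hc : s (n + 1) = some (i, ((b i).loop c).2)) : w n = ((b i).loop c).1 := by
  have h2 := h.letter n
  rw [hn, hc, gadgetLetter_choose] at h2
  exact (Option.some_injective _ h2).symm

theorem root (h : GadgetPath b s w) : ∃ i, s 1 = some (i, (b i).stem.2) ∧ w 0 = (b i).stem.1 := by
  have h1 := h.step 0
  have h2 := h.letter 0
  rw [h.start] at h1 h2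
  simp only [zero_add] at h1 h2
  cases hs : s 1 with
  | none => rw [hs] at h1; cases h1
  | some t =>
    rw [hs] at h1 h2
    cases h1 with
    | root i => exact ⟨i, rfl, (Option.some_injective _ h2).symm⟩

theorem segment (h : GadgetPath b s w) {i : ι} {l : List Γ} {n : ℕ} (hn : s n = some (i, l)) :
    (∀ a ∈ l, ∃ k ≥ n, w k = a) ∧ s (n + l.length) = some (i, []) := by
  induction l generalizing n with
  | nil => exact ⟨by simp, hn⟩
  | cons a l ih =>
    obtain ⟨h1, h2⟩ := h.read hn
    obtain ⟨h3, h4⟩ := ih h1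
    refine ⟨fun a' ha' => ?_, by rw [List.length_cons, ← h4]; congr 1; omega⟩
    rcases List.mem_cons.1 ha' with rfl | ha'
    · exact ⟨n, le_rfl, h2⟩
    · obtain ⟨k, hk, hka⟩ := h3 a' ha'
      exact ⟨k, by omega, hka⟩

theorem exists_position (h : GadgetPath b s w) {i : ι} (h1 : s 1 = some (i, (b i).stem.2)) (n : ℕ) :
    ∃ l, s (n + 1) = some (i, l) := by
  induction n with
  | zero => exact ⟨_, h1⟩
  | succ n ih =>
    obtain ⟨_ | ⟨a, l⟩, hl⟩ := ih
    · obtain ⟨c, hc⟩ := h.choose hl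
      exact ⟨_, hc⟩
    · exact ⟨l, (h.read hl).1⟩

theorem frequently_choice (h : GadgetPath b s w) {i : ι} (h1 : s 1 = some (i, (b i).stem.2)) :
    ∃ᶠ n in Filter.atTop, s n = some (i, []) := by
  refine Filter.frequently_atTop.2 fun N => ?_
  obtain ⟨l, hl⟩ := h.exists_position h1 N
  exact ⟨_, by omega, (h.segment hl).2⟩

/-- The letters that recur on a path are those of the loops that Eve chooses infinitely often. -/
theorem infOcc_eq (h : GadgetPath b s w) {i : ι} (h1 : s 1 = some (i, (b i).stem.2)) (Z : Set Bool)
    (hZ : ∀ n c, s n = some (i, []) → s (n + 1) = some (i, ((b i).loop c).2) → c ∈ Z)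
    (hfreq : ∀ c ∈ Z, ∃ᶠ n in Filter.atTop,
      s n = some (i, []) ∧ s (n + 1) = some (i, ((b i).loop c).2)) :
    infOcc w = {a | ∃ c ∈ Z, a ∈ (b i).word c} := by
  apply Set.Subset.antisymm
  · obtain ⟨n₀, hn₀⟩ := (h.frequently_choice h1).exists
    have key : ∀ n ≥ n₀, ∃ l, s n = some (i, l) ∧ ∀ a ∈ l, ∃ c ∈ Z, a ∈ (b i).word c := by
      intro n hn
      induction n, hn using Nat.le_induction with
      | base => exact ⟨[], hn₀, by simp⟩
      | succ n _ ih =>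
        obtain ⟨_ | ⟨a, l⟩, hl, hlZ⟩ := ih
        · obtain ⟨c, hc⟩ := h.choose hl
          exact ⟨_, hc, fun a ha => ⟨c, hZ n c hl hc, List.mem_cons_of_mem _ ha⟩⟩
        · exact ⟨l, (h.read hl).1, fun a' ha' => hlZ a' (List.mem_cons_of_mem _ ha')⟩
    refine infOcc_subset (Filter.eventually_atTop.2 ⟨n₀, fun n hn => ?_⟩)
    obtain ⟨_ | ⟨a, l⟩, hl, hlZ⟩ := key n hn
    · obtain ⟨c, hc⟩ := h.choose hl
      exact ⟨c, hZ n c hl hc, by rw [h.letter_choose hl hc]; exact List.mem_cons_self⟩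
    · rw [(h.read hl).2]
      exact hlZ a List.mem_cons_self
  · rintro a ⟨c, hc, ha⟩
    refine Filter.frequently_atTop.2 fun N => ?_
    obtain ⟨n, hn, hn1, hn2⟩ := Filter.frequently_atTop.1 (hfreq c hc) N
    rcases List.mem_cons.1 ha with rfl | ha
    · exact ⟨n, hn, h.letter_choose hn1 hn2⟩
    · obtain ⟨k, hk, hka⟩ := (h.segment hn2).1 a ha
      exact ⟨k, by omega, hka⟩

end GadgetPath

/-- The game assembled from gadgets. Its vertices, in an arbitrary universe, are numbers for the
finitely many positions in which fewer than `B` letters remain to be read. -/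
noncomputable def gadgetArena [Nonempty ι] (b : ι → Gadget Γ) {B : ℕ}
    (hB : ∀ i, (b i).stem.2.length < B ∧ ∀ c, ((b i).loop c).2.length < B) {V : Type u}
    (pos : V ≃ {s : Option (ι × List Γ) // GadgetBound B s}) : Arena.{u, v} Γ where
  Vertex := V
  eve := {x | ∃ i, (pos x).1 = some (i, [])}
  edges := {p | GadgetStep b (pos p.1).1 (pos p.2).1}
  start := pos.symm ⟨none, fun _ _ h => by cases h⟩
  colour p := gadgetLetter b (pos p.1.1).1 (pos p.1.2).1
  exists_edge x := by
    obtain ⟨t, ht⟩ := exists_gadgetStep (b := b) (pos x).1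
    refine ⟨pos.symm ⟨t, ht.bound hB (pos x).2⟩, ?_⟩
    change GadgetStep b _ (pos (pos.symm _)).1
    rwa [Equiv.apply_symm_apply]
  no_eps_cycle x h := by
    obtain ⟨_, ⟨h1, h2⟩, -⟩ := Relation.TransGen.head'_iff.1 h
    exact GadgetStep.letter_ne_none h1 h2

variable [Nonempty ι] {B : ℕ}
  {hB : ∀ i, (b i).stem.2.length < B ∧ ∀ c, ((b i).loop c).2.length < B} {V : Type u}
  {pos : V ≃ {s : Option (ι × List Γ) // GadgetBound B s}}

theorem epsFree_gadgetArena : (gadgetArena b hB pos).EpsFree :=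
  fun e => GadgetStep.letter_ne_none e.2

theorem gadgetPath_of_isPlay {ρ : ℕ → (gadgetArena b hB pos).Edge}
    (hρ : (gadgetArena b hB pos).IsPlay ρ) : ∃ w, (gadgetArena b hB pos).IsOutput ρ w ∧
      GadgetPath b (fun n => (pos ((gadgetArena b hB pos).src (ρ n))).1) w := by
  have hc : ∀ n, ∃ a, (gadgetArena b hB pos).colour (ρ n) = some a := fun n =>
    Option.ne_none_iff_exists'.1 (epsFree_gadgetArena (ρ n))
  choose w hw using hc
  refine ⟨w, Arena.isOutput_of_epsFree hw, ⟨?_, fun n => ?_, fun n => ?_⟩⟩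
  · rw [hρ.1]
    simp [gadgetArena]
  · rw [← hρ.2]
    exact (ρ n).2
  · rw [← hρ.2]
    exact hw n

/-- Eve wins if all words alternating between the two loops of a gadget are accepted. She changes
the loop every `B` moves, which is long enough to reach the vertex of choice in between. -/
theorem eveWins_gadgetArena {F : Set (Set Γ)}
    (hF : ∀ i, {a | a ∈ (b i).word true ++ (b i).word false} ∈ F) :
    (gadgetArena b hB pos).EveWins (mullerLanguage F) := by
  classical
  set G := gadgetArena b hB pos with hG
  let bit : ℕ → Bool := fun n => decide (Even (n / B))
  have hedge : ∀ (x : V) (n : ℕ), ∃ e : G.Edge, G.src e = x ∧ ∀ i, (pos x).1 = some (i, []) →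
      (pos (G.tgt e)).1 = some (i, ((b i).loop (bit n)).2) := by
    intro x n
    by_cases hx : ∃ i, (pos x).1 = some (i, [])
    · obtain ⟨i, hi⟩ := hx
      have hst : GadgetStep b (pos x).1 (some (i, ((b i).loop (bit n)).2)) := hi ▸ .choose i _
      have hst' : GadgetStep b (pos x).1
          (pos (pos.symm ⟨_, hst.bound hB (pos x).2⟩)).1 := by
        rwa [Equiv.apply_symm_apply]
      refine ⟨⟨(x, pos.symm ⟨_, hst.bound hB (pos x).2⟩), hst'⟩, rfl, fun j hj => ?_⟩
      have hij : i = j := by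
        rw [hi] at hj
        simpa using hj
      subst hij
      simp [Arena.tgt]
    · exact ⟨G.someEdge x, rfl, fun i hi => absurd ⟨i, hi⟩ hx⟩
  choose mv hsrc htgt using hedge
  refine ⟨fun l => mv (G.lastVertex l) l.length, fun l _ _ => hsrc _ _, fun ρ hρ had => ?_⟩
  obtain ⟨w, hw, hpath⟩ := gadgetPath_of_isPlay hρ
  refine ⟨w, hw, ?_⟩
  set s : ℕ → Option (ι × List Γ) := fun n => (pos (G.src (ρ n))).1 with hs
  obtain ⟨i, hi, -⟩ := hpath.root
  have hbit : ∀ n, s n = some (i, []) → s (n + 1) = some (i, ((b i).loop (bit n)).2) := by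
    intro n hn
    have h1 := had n (by rw [Arena.lastVertex_prefixOf hρ]; exact ⟨i, hn⟩)
    dsimp only at h1
    rw [Arena.lastVertex_prefixOf hρ] at h1
    have h2 := htgt (G.src (ρ n)) (G.prefixOf ρ n).length i hn
    rw [← h1, hρ.2] at h2
    simpa [Arena.prefixOf] using h2
  have := hpath.infOcc_eq hi Set.univ (fun _ _ _ _ => Set.mem_univ _) fun c _ => by
    refine Filter.frequently_atTop.2 fun N => ?_
    have hB0 : 0 < B := (Nat.zero_le _).trans_lt (hB i).1
    let d : ℕ := 2 * (N + 1) + if c then 0 else 1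
    have hd : N + 1 ≤ B * d := by
      calc N + 1 ≤ d := by simp only [d]; omega
        _ ≤ B * d := Nat.le_mul_of_pos_left d hB0
    obtain ⟨l, hl⟩ := hpath.exists_position hi (B * d - 1)
    rw [Nat.sub_add_cancel (by omega)] at hl
    have hlB : l.length < B := (pos (G.src (ρ (B * d)))).2 i l hl
    have hcen := (hpath.segment hl).2
    refine ⟨_, by omega, hcen, ?_⟩
    have hbc : bit (B * d + l.length) = c := by
      simp only [bit]
      rw [Nat.mul_add_div hB0, Nat.div_eq_of_lt hlB]
      cases c <;> simp [d]
    have := hbit _ hcen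
    rwa [hbc] at this
  rw [mullerLanguage, Set.mem_ofPred_eq, this]
  convert hF i using 2
  ext a
  simp [or_comm]

/-- A chromatic memory whose state before each choice in gadget `i` is the same makes Eve repeat one
loop, so she loses if both loops are rejected. -/
theorem not_setsWinningStrategy_gadgetArena {F : Set (Set Γ)} (i : ι)
    (hF : ∀ c, {a | a ∈ (b i).word c} ∉ F) (M : Memory (gadgetArena b hB pos))
    (f : M.State → Γ → M.State)
    (hM : ∀ m e c, (gadgetArena b hB pos).colour e = some c → M.update m e = f m c) (q : M.State)
    (hstem : ((b i).stem.1 :: (b i).stem.2).foldl f M.start = q)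
    (hloop : ∀ c, ((b i).word c).foldl f q = q) :
    ¬ M.SetsWinningStrategy (mullerLanguage F) := by
  revert M
  set G := gadgetArena b hB pos with hG
  intro M f hM q hstem hloop
  rintro ⟨next, hsrc, -, hwin⟩
  have hbdd0 : GadgetBound B (some (i, ([] : List Γ)) : Option (ι × List Γ)) := by
    intro j l h
    simp only [Option.some.injEq, Prod.mk.injEq] at h
    rw [← h.2]
    exact (Nat.zero_le _).trans_lt (hB i).1
  let centre : G.eve := ⟨pos.symm ⟨_, hbdd0⟩, i, by rw [Equiv.apply_symm_apply]⟩
  obtain ⟨c, hc⟩ : ∃ c, (pos (G.tgt (next centre q))).1 = some (i, ((b i).loop c).2) := by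
    have h1 : GadgetStep b (pos (G.src (next centre q))).1 (pos (G.tgt (next centre q))).1 :=
      (next centre q).2
    rw [hsrc, Equiv.apply_symm_apply] at h1
    generalize (pos (G.tgt (next centre q))).1 = t at h1
    cases h1 with
    | choose _ c => exact ⟨c, rfl⟩
  -- The play in which Adam chooses gadget `i` and Eve always chooses loop `c`.
  let nxt : Option (ι × List Γ) → Option (ι × List Γ)
    | none => some (i, (b i).stem.2)
    | some (j, []) => some (j, ((b j).loop c).2)
    | some (j, _ :: l) => some (j, l)
  have hnxt : ∀ s, GadgetStep b s (nxt s) := by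
    rintro (_ | ⟨j, _ | ⟨a, l⟩⟩)
    · exact .root i
    · exact .choose j c
    · exact .read j a l
  obtain ⟨s, hs0, hs⟩ : ∃ s : ℕ → {s : Option (ι × List Γ) // GadgetBound B s},
      (s 0).1 = none ∧ ∀ n, (s (n + 1)).1 = nxt (s n).1 :=
    ⟨fun n => Nat.rec ⟨none, fun _ _ h => by cases h⟩
      (fun _ t => ⟨nxt t.1, (hnxt t.1).bound hB t.2⟩) n, rfl, fun _ => rfl⟩
  let ρ : ℕ → G.Edge := fun n => ⟨(pos.symm (s n), pos.symm (s (n + 1))), by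
    change GadgetStep b (pos (pos.symm _)).1 (pos (pos.symm _)).1
    rw [Equiv.apply_symm_apply, Equiv.apply_symm_apply, hs]
    exact hnxt _⟩
  have hρ : G.IsPlay ρ := ⟨congrArg pos.symm (Subtype.ext hs0), fun n => rfl⟩
  obtain ⟨w, hw, hpath⟩ := gadgetPath_of_isPlay hρ
  have hpos : (fun n => (pos (G.src (ρ n))).1) = fun n => (s n).1 := by
    funext n
    change (pos (pos.symm (s n))).1 = _
    rw [Equiv.apply_symm_apply]
  rw [hpos] at hpath
  have h1 : (s 1).1 = some (i, (b i).stem.2) := by rw [hs, hs0]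
  have hmem : ∀ n, M.stateAfter (G.prefixOf ρ (n + 1)) =
      f (M.stateAfter (G.prefixOf ρ n)) (w n) := fun n => by
    rw [Memory.stateAfter_prefixOf_succ]
    exact hM _ _ _ (hw.colour_eq epsFree_gadgetArena n)
  -- Reading the rest of the current word always leads the memory to `q`.
  have hinv : ∀ n, ∃ l, (s (n + 1)).1 = some (i, l) ∧
      l.foldl f (M.stateAfter (G.prefixOf ρ (n + 1))) = q := by
    intro n
    induction n with
    | zero =>
      refine ⟨_, h1, ?_⟩
      obtain ⟨j, hj, hj0⟩ := hpath.root
      have hij : i = j := by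
        rw [h1] at hj
        simp only [Option.some.injEq, Prod.mk.injEq] at hj
        exact hj.1
      subst hij
      rw [hmem, hj0, ← hstem]
      rfl
    | succ n ih =>
      obtain ⟨_ | ⟨a, l⟩, hl, hlq⟩ := ih
      · have h2 : (s (n + 1 + 1)).1 = some (i, ((b i).loop c).2) := by rw [hs, hl]
        refine ⟨_, h2, ?_⟩
        rw [hmem, hpath.letter_choose hl h2]
        simp only [List.foldl_nil] at hlq
        rw [hlq]
        exact hloop c
      · obtain ⟨h2, h3⟩ := hpath.read hl
        refine ⟨l, h2, ?_⟩
        rw [hmem, h3]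
        exact hlq
  have had : G.Adheres (M.strategy next) ρ := by
    intro n hn
    rw [Memory.strategy, dif_pos hn]
    have hv : G.lastVertex (G.prefixOf ρ n) = pos.symm (s n) := Arena.lastVertex_prefixOf hρ n
    obtain ⟨j, hj⟩ := id hn
    rw [hv, Equiv.apply_symm_apply] at hj
    cases n with
    | zero =>
      rw [hs0] at hj
      cases hj
    | succ n =>
      obtain ⟨l, hl, hlq⟩ := hinv n
      rw [hl] at hj
      simp only [Option.some.injEq, Prod.mk.injEq] at hj
      obtain ⟨rfl, rfl⟩ := hj
      simp only [List.foldl_nil] at hlq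
      have hcen : (⟨G.lastVertex (G.prefixOf ρ (n + 1)), hn⟩ : G.eve) = centre := by
        apply Subtype.ext
        change G.lastVertex _ = pos.symm _
        rw [hv]
        congr 1
        exact Subtype.ext hl
      rw [hcen, hlq]
      apply Subtype.ext
      refine Prod.ext ?_ ?_
      · change pos.symm (s (n + 1)) = G.src _
        rw [hsrc, ← hcen]
        exact hv.symm
      · change pos.symm (s (n + 1 + 1)) = G.tgt _
        refine (Equiv.symm_apply_eq pos).2 (Subtype.ext ?_)
        rw [hc, hs, hl]
  obtain ⟨w', hw', hL⟩ := hwin ρ hρ had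
  have hww : w' = w := by
    funext n
    exact Option.some_injective _ ((hw'.colour_eq epsFree_gadgetArena n).symm.trans
      (hw.colour_eq epsFree_gadgetArena n))
  rw [hww, mullerLanguage, Set.mem_ofPred_eq] at hL
  have hcc : ∀ n, (s n).1 = some (i, []) → (s (n + 1)).1 = some (i, ((b i).loop c).2) := by
    intro n hn
    rw [hs, hn]
  refine hF c ?_
  convert hL
  rw [hpath.infOcc_eq h1 {c} (fun n d hn hd => ?_) (fun d hd => ?_)]
  · simp
  · have := (hcc n hn).symm.trans hd
    simp only [Option.some.injEq, Prod.mk.injEq, true_and] at this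
    exact ((b i).eq_of_loop_eq this).symm
  · rw [Set.mem_singleton_iff.1 hd]
    exact (hpath.frequently_choice h1).mono fun n hn => ⟨hn, hcc n hn⟩

end Gadget

/-! ### From chromatic memories to Rabin automata -/

/-- Two rejecting cycles at a state, with accepting union, give a gadget. -/
theorem ColourMemory.exists_gadget {Γ : Type v} {M : ColourMemory Γ} {F : Set (Set Γ)}
    (hM : ¬ M.RejectsUnions F) : ∃ (g : Gadget Γ) (q : M.State),
      M.run M.start (g.stem.1 :: g.stem.2) = q ∧ (∀ c, M.run q (g.word c) = q) ∧
      (∀ c, {a | a ∈ g.word c} ∉ F) ∧ {a | a ∈ g.word true ++ g.word false} ∈ F := by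
  simp only [RejectsUnions] at hM
  push Not at hM
  obtain ⟨q, x, y, ⟨⟨⟨z, hz⟩, hx0, hxq⟩, hxF⟩, ⟨⟨-, hy0, hyq⟩, hyF⟩, hxy⟩ := hM
  obtain ⟨u₀, u₁, hu⟩ := List.exists_cons_of_ne_nil (l := z ++ x) (by simp [hx0])
  have huq : M.run M.start (u₀ :: u₁) = q := by rw [← hu, run_append, hz, hxq]
  -- If both words have the same length, the first one is repeated.
  obtain ⟨x', hx'q, hx'x, hlen⟩ : ∃ x', M.run q x' = q ∧ (∀ a, a ∈ x' ↔ a ∈ x) ∧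
      x'.length ≠ y.length := by
    by_cases hl : x.length = y.length
    · refine ⟨x ++ x, by rw [run_append, hxq, hxq], by simp, ?_⟩
      have := List.length_pos_iff.2 hx0
      rw [List.length_append]
      omega
    · exact ⟨x, hxq, fun _ => Iff.rfl, hl⟩
  have hx'0 : x' ≠ [] := by
    rintro rfl
    refine hx0 (List.eq_nil_iff_forall_not_mem.2 fun a ha => ?_)
    simpa using (hx'x a).2 ha
  obtain ⟨x₀, x₁, rfl⟩ := List.exists_cons_of_ne_nil hx'0
  obtain ⟨y₀, y₁, rfl⟩ := List.exists_cons_of_ne_nil hy0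
  refine ⟨⟨(u₀, u₁), fun c => if c then (x₀, x₁) else (y₀, y₁), fun h => hlen ?_⟩, q, huq, ?_, ?_,
    ?_⟩
  · simp only [if_true, Bool.false_eq_true, if_false] at h
    rw [List.length_cons, List.length_cons, h]
  · rintro (_ | _)
    · exact hyq
    · exact hx'q
  · rintro (_ | _)
    · exact hyF
    · convert hxF using 3
      exact funext fun a => propext (hx'x a)
  · convert hxy using 2
    ext a
    simp only [Gadget.word, List.mem_append, if_true, Bool.false_eq_true,
      if_false, hx'x]

theorem finite_gadgetBound {Γ ι : Type v} [Finite Γ] [Finite ι] (B : ℕ) :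
    Finite {s : Option (ι × List Γ) // GadgetBound B s} := by
  refine Set.Finite.to_subtype (s := {s | GadgetBound B s}) ?_
  have hfin : (Set.univ ×ˢ {l : List Γ | l.length < B} : Set (ι × List Γ)).Finite :=
    Set.finite_univ.prod (List.finite_length_lt Γ B)
  refine ((hfin.image some).insert none).subset ?_
  rintro (_ | ⟨i, l⟩) hs
  · exact Or.inl rfl
  · exact Or.inr ⟨(i, l), ⟨Set.mem_univ _, hs i l rfl⟩, rfl⟩

/-- If chromatic memories of size `n` suffice in all finite games without neutral colours, then some
Rabin automaton has `n` states. Otherwise each of the finitely many memories with states `Fin n`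
confuses the loops of some gadget, and Adam wins against all of them in the game assembled from
these gadgets. -/
theorem mem_rabinSizes_of_mem_chromaticSizes {Γ : Type v} [Finite Γ] {F : Set (Set Γ)} {n : ℕ}
    (hn : n ∈ chromaticSizes (finiteGames.{u, v} Γ ∩ epsFreeGames.{u, v} Γ) (mullerLanguage F)) :
    n ∈ rabinSizes (mullerLanguage F) := by
  obtain ⟨hpos, hn⟩ := hn
  by_contra hcon
  let ι := Fin n × (Fin n → Γ → Fin n)
  let N : ι → ColourMemory Γ := fun i => ⟨Fin n, i.1, i.2⟩
  have hN : ∀ i, ¬ (N i).RejectsUnions F := by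
    intro i h
    have : Finite (N i).State := inferInstanceAs (Finite (Fin n))
    refine hcon ?_
    convert h.mem_rabinSizes
    exact (Nat.card_fin n).symm
  have : Nonempty ι := ⟨(⟨0, hpos⟩, fun m _ => m)⟩
  choose b q hstem hloop hF hFu using fun i => ColourMemory.exists_gadget (hN i)
  obtain ⟨B, hB⟩ : ∃ B, ∀ i, (b i).stem.2.length < B ∧ ∀ c, ((b i).loop c).2.length < B := by
    obtain ⟨B, hB⟩ := (Set.finite_range fun i => (b i).stem.2.length).bddAbove
    obtain ⟨B', hB'⟩ :=
      (Set.finite_range fun p : ι × Bool => ((b p.1).loop p.2).2.length).bddAbove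
    refine ⟨max B B' + 1, fun i => ⟨?_, fun c => ?_⟩⟩
    · have : (b i).stem.2.length ≤ B := hB ⟨i, rfl⟩
      omega
    · have : ((b i).loop c).2.length ≤ B' := hB' ⟨(i, c), rfl⟩
      omega
  have := finite_gadgetBound (Γ := Γ) (ι := ι) B
  obtain ⟨k, ⟨enc⟩⟩ := Finite.exists_equiv_fin {s : Option (ι × List Γ) // GadgetBound B s}
  let pos : ULift.{u} (Fin k) ≃ _ := Equiv.ulift.trans enc.symm
  obtain ⟨M, hMfin, hMcard, ⟨f, hf⟩, hMwin⟩ := hn (gadgetArena b hB pos)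
    ⟨inferInstanceAs (Finite (ULift.{u} (Fin k))), epsFree_gadgetArena⟩ (eveWins_gadgetArena hFu)
  let ψ : M.State ≃ Fin n := Finite.equivFinOfCardEq hMcard
  let i : ι := (ψ M.start, fun m a => ψ (f (ψ.symm m) a))
  have hψ : ∀ (x : List Γ) (m : M.State), ψ (x.foldl f m) = (N i).run (ψ m) x := by
    intro x
    induction x with
    | nil => exact fun _ => rfl
    | cons a x ih =>
      intro m
      rw [List.foldl_cons, ih]
      simp [ColourMemory.run, N, i]
  refine not_setsWinningStrategy_gadgetArena i (hF i) M f (fun m e => (hf m e).1)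
    (ψ.symm (q i)) ?_ (fun c => ?_) hMwin
  · rw [Equiv.eq_symm_apply, hψ]
    exact hstem i
  · rw [Equiv.eq_symm_apply, hψ, Equiv.apply_symm_apply]
    exact hloop i c

/-! ### Comparison of the sizes -/

theorem independentSizes_anti {Γ : Type v} {C C' : Set (Arena.{u, v} Γ)} (h : C ⊆ C')
    (W : Set (ℕ → Γ)) : independentSizes C' W ⊆ independentSizes C W := by
  rintro n ⟨M, hfin, hcard, hM⟩
  exact ⟨M, hfin, hcard, fun G hG => hM G (h hG)⟩

theorem chromaticSizes_anti {Γ : Type v} {C C' : Set (Arena.{u, v} Γ)} (h : C ⊆ C')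
    (W : Set (ℕ → Γ)) : chromaticSizes C' W ⊆ chromaticSizes C W :=
  fun _ hn => ⟨hn.1, fun G hG => hn.2 G (h hG)⟩

theorem independentSizes_subset_chromaticSizes {Γ : Type v} (C : Set (Arena.{u, v} Γ))
    (W : Set (ℕ → Γ)) : independentSizes C W ⊆ chromaticSizes C W := by
  rintro n ⟨M, hfin, rfl, hM⟩
  have : Nonempty M.State := ⟨M.start⟩
  refine ⟨Nat.card_pos, fun G hG hwin => ⟨M.toMemory G, hfin, rfl, ⟨M.update, fun m e => ?_⟩,
    hM G hG hwin⟩⟩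
  constructor
  · intro c hc
    simp [ColourMemory.toMemory, hc]
  · intro hc
    simp only [ColourMemory.toMemory, hc]
    rfl

theorem rabinSizes_subset_independentSizes {Γ : Type v} (C : Set (Arena.{u, v} Γ))
    (W : Set (ℕ → Γ)) : rabinSizes W ⊆ independentSizes C W := by
  rintro n ⟨𝒜, h𝒜, rfl, hcard⟩
  exact ⟨𝒜.toColourMemory, 𝒜.finite_state, hcard, 𝒜.isArenaIndependent_toColourMemory h𝒜 C⟩

end ChromaticMemory

open ChromaticMemory in
theorem theorem4p2 {Γ : Type v} [Finite Γ] (F : Set (Set Γ)) :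
    ∃ n : ℕ,
      IsLeast (rabinSizes (mullerLanguage F)) n ∧
      -- games of arbitrary cardinality
      IsLeast (independentSizes (allGames.{u, v} Γ) (mullerLanguage F)) n ∧
      IsLeast (independentSizes (epsFreeGames.{u, v} Γ) (mullerLanguage F)) n ∧
      IsLeast (chromaticSizes (allGames.{u, v} Γ) (mullerLanguage F)) n ∧
      IsLeast (chromaticSizes (epsFreeGames.{u, v} Γ) (mullerLanguage F)) n ∧
      -- finite games
      IsLeast (independentSizes (finiteGames.{u, v} Γ) (mullerLanguage F)) n ∧
      IsLeast (independentSizes (finiteGames.{u, v} Γ ∩ epsFreeGames.{u, v} Γ)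
        (mullerLanguage F)) n ∧
      IsLeast (chromaticSizes (finiteGames.{u, v} Γ) (mullerLanguage F)) n ∧
      IsLeast (chromaticSizes (finiteGames.{u, v} Γ ∩ epsFreeGames.{u, v} Γ)
        (mullerLanguage F)) n := by
  have hleast : IsLeast (rabinSizes (mullerLanguage F)) (sInf (rabinSizes (mullerLanguage F))) :=
    ⟨Nat.sInf_mem (rabinSizes_nonempty F), fun n hn => Nat.sInf_le hn⟩
  set n := sInf (rabinSizes (mullerLanguage F))
  have hind : ∀ C : Set (Arena.{u, v} Γ), finiteGames.{u, v} Γ ∩ epsFreeGames.{u, v} Γ ⊆ C →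
      IsLeast (independentSizes C (mullerLanguage F)) n := fun C hC =>
    ⟨rabinSizes_subset_independentSizes C _ hleast.1, fun m hm => hleast.2
      (mem_rabinSizes_of_mem_chromaticSizes
        (independentSizes_subset_chromaticSizes _ _ (independentSizes_anti hC _ hm)))⟩
  have hchr : ∀ C : Set (Arena.{u, v} Γ), finiteGames.{u, v} Γ ∩ epsFreeGames.{u, v} Γ ⊆ C →
      IsLeast (chromaticSizes C (mullerLanguage F)) n := fun C hC =>
    ⟨independentSizes_subset_chromaticSizes _ _
      (rabinSizes_subset_independentSizes C _ hleast.1), fun m hm => hleast.2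
      (mem_rabinSizes_of_mem_chromaticSizes (chromaticSizes_anti hC _ hm))⟩
  exact ⟨n, hleast, hind _ (Set.subset_univ _), hind _ Set.inter_subset_right,
    hchr _ (Set.subset_univ _), hchr _ Set.inter_subset_right, hind _ Set.inter_subset_left,
    hind _ subset_rfl, hchr _ Set.inter_subset_left, hchr _ subset_rfl⟩
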